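/- Let $E_j^k$ denote the $(2m-1)\times(2m-1)$ matrix with entry $1$ in row $j$ and column $k$ and $0$ elsewhere. Let $SU(m,m-1)$ be the group of complex $(2m-1)\times(2m-1)$ matrices $g$ with $\det g=1$ and $g^*Dg=D$, where $D=\mathrm{diag}(1,\dots,1,-1,\dots,-1)$ has $m$ entries $1$ and $m-1$ entries $-1$. A complex product structure on a smooth manifold $M$ is a pair $(P,J)$ of smooth fields of endomorphisms of $TM$ with $P^2=1$, $P$ of constant trace, $J^2=-1$, $PJ=-JP$ and, for all smooth vector fields $X,Y$ on $M$, $$[PX,PY]+[X,Y]-P[PX,Y]-P[X,PY]=0,\qquad [JX,JY]-[X,Y]-J[JX,Y]-J[X,JY]=0.$$ **Theorem.** For every integer $m>1$, the manifolds underlying the Lie groups $SL(2m-1,\mathbb R)$ and $SU(m,m-1)$ have complex product structures $(P,J)$ that are invariant under left translations. More precisely, there is such a structure whose value at the identity, that is, on the Lie algebra, is given by $$J(U)=V,\quad J(S)=T,\quad P(U)=T,\quad P(V)=S$$ (together with $P^2=1$, $J^2=-1$) for each quadruple $(U,V,S,T)=(U^j,V^j,S^j,T^j)$ and $(U,V,S,T)=(U_j^k,V_j^k,S_j^k,T_j^k)$,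 $1\le j\le m-1$, $j<k<2m-j$, of the following basis of the Lie algebra. For $\mathfrak{sl}(2m-1,\mathbb R)$: $$U^j=E_j^j+E_{2m-j}^{2m-j}-2E_m^m,\quad V^j=E_j^{2m-j}-E_{2m-j}^j,\quad S^j=E_j^{2m-j}+E_{2m-j}^j,\quad T^j=E_j^j-E_{2m-j}^{2m-j},$$ $$U_j^k=E_j^k-E_k^j,\quad V_j^k=E_k^{2m-j}-E_{2m-j}^k,\quad S_j^k=E_k^{2m-j}+E_{2m-j}^k,\quad T_j^k=E_j^k+E_k^j.$$ For $\mathfrak{su}(m,m-1)$: $$U^j=i(E_j^j+E_{2m-j}^{2m-j}-2E_m^m),\quad V^j=i(E_j^j-E_{2m-j}^{2m-j}),\quad S^j=E_j^{2m-j}+E_{2m-j}^j,\quad T^j=i(E_j^{2m-j}-E_{2m-j}^j),$$ for $j<k\le m$: $$U_j^k=E_j^k-E_k^j,\quad V_j^k=i(E_j^k+E_k^j),\quad S_j^k=E_k^{2m-j}+E_{2m-j}^k,\quad T_j^k=i(E_k^{2m-j}-E_{2m-j}^k),$$ and for $m<k<2m-j$: $$U_j^k=E_k^{2m-j}-E_{2m-j}^k,\quad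 V_j^k=i(E_k^{2m-j}+E_{2m-j}^k),\quad S_j^k=-E_j^k-E_k^j,\quad T_j^k=i(E_k^j-E_j^k).$$ -/

import Mathlib

open Matrix Set Filter Topology Manifold ContDiff
open scoped Matrix.Norms.Operator

noncomputable section

set_option linter.unusedSectionVars false

section LinearGroups

variable {A : Type*} [NormedRing A] [NormedAlgebra ℝ A] [CompleteSpace A]

variable (A) in
/-- The exponential map of a Banach algebra near `0`, as a local diffeomorphism. -/
def expLocal : OpenPartialHomeomorph A A :=
  ((NormedSpace.exp_analytic (𝕂 := ℝ) (0 : A)).contDiffAt (n := ω)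
    |>.toOpenPartialHomeomorph NormedSpace.exp
      (f' := ContinuousLinearEquiv.refl ℝ A) hasFDerivAt_exp_zero (by simp)).restrContDiff ℝ ω
      (by simp)

lemma expLocal_coe : (expLocal A : A → A) = NormedSpace.exp := rfl

lemma zero_mem_expLocal_source : (0 : A) ∈ (expLocal A).source := by
  have h : ContDiffAt ℝ ω (NormedSpace.exp : A → A) 0 :=
    (NormedSpace.exp_analytic (𝕂 := ℝ) (0 : A)).contDiffAt
  have h' : HasFDerivAt (NormedSpace.exp : A → A)
      ((ContinuousLinearEquiv.refl ℝ A : A ≃L[ℝ] A) : A →L[ℝ] A) 0 := hasFDerivAt_exp_zero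
  exact ⟨h.mem_toOpenPartialHomeomorph_source h' (by simp), h, h.to_localInverse h' (by simp)⟩

lemma contDiffAt_expLocal_symm {y : A} (hy : y ∈ (expLocal A).target) :
    ContDiffAt ℝ ω (expLocal A).symm y :=
  hy.2.1

/-- A topological group `G` embedded in a Banach algebra `A`, together with a subspace of `A`,
the range of `tang : E → A`, such that `exp` maps the elements near `0` of this subspace, and no
other elements of `A` near `0`, to elements of `G`. -/
structure LinearGroupData (G : Type*) [Group G] [TopologicalSpace G]
    (A : Type*) [NormedRing A] [NormedAlgebra ℝ A]
    (E : Type*) [NormedAddCommGroup E] [NormedSpace ℝ E] where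
  incl : G →* A
  isEmbedding_incl : IsEmbedding incl
  tang : E →L[ℝ] A
  proj : A →L[ℝ] E
  proj_tang : ∀ X : E, proj (tang X) = X
  exp_mem_iff : ∀ᶠ X in 𝓝 (0 : A), NormedSpace.exp X ∈ range incl ↔ X ∈ range tang

namespace LinearGroupData

variable {G : Type*} [Group G] [TopologicalSpace G] {E : Type*}
  [NormedAddCommGroup E] [NormedSpace ℝ E] (D : LinearGroupData G A E)

/-- A neighbourhood of `0` in `A` on which `exp` is injective and detects the range of `tang`. -/
def nhd : Set A :=
  (expLocal A).source ∩ interior {X | NormedSpace.exp X ∈ range D.incl ↔ X ∈ range D.tang}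

lemma isOpen_nhd : IsOpen D.nhd := (expLocal A).open_source.inter isOpen_interior

lemma zero_mem_nhd : (0 : A) ∈ D.nhd :=
  ⟨zero_mem_expLocal_source, mem_interior_iff_mem_nhds.2 D.exp_mem_iff⟩

/-- The logarithm near `1`. -/
def logHomeo : OpenPartialHomeomorph A A :=
  ((expLocal A).restrOpen D.nhd D.isOpen_nhd).symm

lemma logHomeo_target : D.logHomeo.target = D.nhd := by
  ext x
  simp only [logHomeo, OpenPartialHomeomorph.symm_target, OpenPartialHomeomorph.restrOpen_source]
  exact ⟨fun h => h.2, fun h => ⟨h.1, h⟩⟩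

lemma logHomeo_symm_coe : (D.logHomeo.symm : A → A) = NormedSpace.exp := rfl

lemma contDiffAt_logHomeo {y : A} (hy : y ∈ D.logHomeo.source) :
    ContDiffAt ℝ ω D.logHomeo y :=
  contDiffAt_expLocal_symm hy.1

lemma one_mem_logHomeo_source : (1 : A) ∈ D.logHomeo.source := by
  have h := D.logHomeo.map_target (x := 0) (by rw [logHomeo_target]; exact D.zero_mem_nhd)
  rwa [D.logHomeo_symm_coe, NormedSpace.exp_zero] at h

lemma exp_mem_range_iff {X : A} (hX : X ∈ D.nhd) :
    NormedSpace.exp X ∈ range D.incl ↔ X ∈ range D.tang := by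
  have h := interior_subset hX.2
  exact h

lemma exp_mem_range (X : E) (hX : D.tang X ∈ D.nhd) : NormedSpace.exp (D.tang X) ∈ range D.incl :=
  (D.exp_mem_range_iff hX).2 ⟨X, rfl⟩

lemma logHomeo_mem {g : G} (hg : D.incl g ∈ D.logHomeo.source) : D.logHomeo (D.incl g) ∈ range D.tang := by
  have h := D.logHomeo.map_source hg
  rw [logHomeo_target] at h
  refine (D.exp_mem_range_iff h).1 ⟨g, ?_⟩
  rw [← D.logHomeo_symm_coe, D.logHomeo.left_inv hg]

open Classical in
/-- The inverse of the logarithmic chart at the identity: the element of `G` represented by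
`exp X`. -/
def expInv (X : E) : G :=
  if h : NormedSpace.exp (D.tang X) ∈ range D.incl then h.choose else 1

lemma incl_expInv (X : E) (hX : D.tang X ∈ D.nhd) :
    D.incl (D.expInv X) = NormedSpace.exp (D.tang X) := by
  rw [expInv, dif_pos (D.exp_mem_range X hX)]
  exact (D.exp_mem_range X hX).choose_spec

lemma coe_proj {X : A} (hX : X ∈ range D.tang) : D.tang (D.proj X) = X := by
  obtain ⟨Y, rfl⟩ := hX
  rw [D.proj_tang]

/-- The logarithmic chart at the identity, `g ↦ log g`. -/
def chartOne : OpenPartialHomeomorph G E where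
  toFun g := D.proj (D.logHomeo (D.incl g))
  invFun := D.expInv
  source := D.incl ⁻¹' D.logHomeo.source
  target := D.tang ⁻¹' D.nhd
  map_source' g hg := by
    have h := D.logHomeo.map_source hg
    rw [logHomeo_target] at h
    rwa [mem_preimage, coe_proj D (D.logHomeo_mem hg)]
  map_target' X hX := by
    have h := D.logHomeo.map_target (x := D.tang X) (by rw [logHomeo_target]; exact hX)
    rwa [mem_preimage, incl_expInv D X hX, ← D.logHomeo_symm_coe]
  left_inv' g hg := by
    apply D.isEmbedding_incl.injective
    have h := D.logHomeo.map_source hg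
    rw [logHomeo_target] at h
    rw [incl_expInv, coe_proj D (D.logHomeo_mem hg), ← D.logHomeo_symm_coe, D.logHomeo.left_inv hg]
    rwa [coe_proj D (D.logHomeo_mem hg)]
  right_inv' X hX := by
    rw [incl_expInv D X hX, ← D.logHomeo_symm_coe, D.logHomeo.right_inv, D.proj_tang]
    rw [logHomeo_target]; exact hX
  open_source := D.logHomeo.open_source.preimage D.isEmbedding_incl.continuous
  open_target := D.isOpen_nhd.preimage D.tang.continuous
  continuousOn_toFun := D.proj.continuous.comp_continuousOn <|
    D.logHomeo.continuousOn.comp D.isEmbedding_incl.continuous.continuousOn fun _ h => h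
  continuousOn_invFun := by
    rw [D.isEmbedding_incl.continuousOn_iff]
    refine ContinuousOn.congr (f := fun X : E => NormedSpace.exp (D.tang X)) ?_
      fun X hX => D.incl_expInv X hX
    have h : Continuous (NormedSpace.exp : A → A) := continuous_iff_continuousAt.2 fun X =>
      (NormedSpace.exp_analytic (𝕂 := ℝ) X).continuousAt
    exact (h.comp D.tang.continuous).continuousOn

lemma contDiff_exp_coe : ContDiff ℝ ω fun X : E => NormedSpace.exp (D.tang X) := by
  have : ContDiff ℝ ω (NormedSpace.exp : A → A) :=
    contDiff_iff_contDiffAt.2 fun X => (NormedSpace.exp_analytic (𝕂 := ℝ) X).contDiffAt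
  exact this.comp D.tang.contDiff

variable [ContinuousMul G]

/-- The logarithmic chart at `g`, `h ↦ log (g⁻¹ h)`. -/
def chart (g : G) : OpenPartialHomeomorph G E :=
  (Homeomorph.mulLeft g⁻¹).toOpenPartialHomeomorph.trans D.chartOne

/-- The manifold structure on `G` given by the logarithmic charts. -/
abbrev chartedSpace : ChartedSpace E G where
  atlas := range D.chart
  chartAt := D.chart
  mem_chart_source g := by
    simp [chart, chartOne, D.one_mem_logHomeo_source]
  chart_mem_atlas := mem_range_self

lemma mem_chart_source {g h : G} :
    h ∈ (D.chart g).source ↔ D.incl (g⁻¹ * h) ∈ D.logHomeo.source := by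
  simp [chart, chartOne]

lemma mem_chart_target {g : G} {X : E} : X ∈ (D.chart g).target ↔ D.tang X ∈ D.nhd := by
  simp [chart, chartOne]

lemma chart_apply (g h : G) : D.chart g h = D.proj (D.logHomeo (D.incl (g⁻¹ * h))) := rfl

lemma incl_chart_symm {g : G} {X : E} (hX : D.tang X ∈ D.nhd) :
    D.incl ((D.chart g).symm X) = D.incl g * NormedSpace.exp (D.tang X) := by
  have : (D.chart g).symm X = g * D.expInv X := by
    change (Homeomorph.mulLeft g⁻¹).symm (D.expInv X) = _
    simp [Homeomorph.mulLeft_symm]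
  rw [this, map_mul, D.incl_expInv X hX]

lemma isManifold :
    letI := D.chartedSpace
    IsManifold 𝓘(ℝ, E) ω G := by
  let _ := D.chartedSpace
  refine isManifold_of_contDiffOn _ _ _ ?_
  rintro _ _ ⟨g, rfl⟩ ⟨h, rfl⟩
  intro X hX
  simp only [modelWithCornersSelf_coe, modelWithCornersSelf_coe_symm, Function.comp_def, id,
    range_id, inter_univ, mem_preimage] at hX ⊢
  have h1 : D.tang X ∈ D.nhd := by
    rw [← D.mem_chart_target (g := g)]
    exact hX.1
  have h2 := hX.2
  apply ContDiffAt.contDiffWithinAt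
  have key : ContDiffAt ℝ ω
      (fun Y : E => D.proj (D.logHomeo (D.incl (h⁻¹ * g) * NormedSpace.exp (D.tang Y)))) X := by
    refine D.proj.contDiff.contDiffAt.comp X ?_
    refine ContDiffAt.comp X (D.contDiffAt_logHomeo ?_)
      (contDiffAt_const.mul D.contDiff_exp_coe.contDiffAt)
    have h3 : (D.chart g).symm X ∈ (D.chart h).source := h2
    have := D.mem_chart_source.1 h3
    rwa [map_mul, D.incl_chart_symm h1, ← mul_assoc, ← map_mul] at this
  refine key.congr_of_eventuallyEq ?_
  filter_upwards [(D.isOpen_nhd.preimage D.tang.continuous).mem_nhds h1] with Y hY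
  simp only [OpenPartialHomeomorph.coe_trans, Function.comp_def, chart_apply]
  rw [map_mul, D.incl_chart_symm hY, ← mul_assoc, ← map_mul]

lemma contMDiff_incl :
    letI := D.chartedSpace
    ContMDiff 𝓘(ℝ, E) 𝓘(ℝ, A) ω D.incl := by
  let _ := D.chartedSpace
  have := D.isManifold
  intro g
  rw [contMDiffAt_iff]
  refine ⟨D.isEmbedding_incl.continuous.continuousAt, ?_⟩
  apply ContDiffAt.contDiffWithinAt
  have h0 : D.tang (extChartAt 𝓘(ℝ, E) g g) ∈ D.nhd :=
    D.mem_chart_target.1 ((D.chart g).map_source (ChartedSpace.mem_chart_source g))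
  refine ContDiffAt.congr_of_eventuallyEq
    (f := fun Y : E => D.incl g * NormedSpace.exp (D.tang Y)) ?_ ?_
  · exact contDiffAt_const.mul D.contDiff_exp_coe.contDiffAt
  · filter_upwards [(D.isOpen_nhd.preimage D.tang.continuous).mem_nhds h0] with Y hY
    exact D.incl_chart_symm hY

lemma contMDiff_of_incl_comp {F H M : Type*} [NormedAddCommGroup F] [NormedSpace ℝ F]
    [TopologicalSpace H] {I : ModelWithCorners ℝ F H} [TopologicalSpace M] [ChartedSpace H M]
    {f : M → G} (hf : ContMDiff I 𝓘(ℝ, A) ω (fun x => D.incl (f x))) :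
    letI := D.chartedSpace
    ContMDiff I 𝓘(ℝ, E) ω f := by
  let _ := D.chartedSpace
  have := D.isManifold
  intro x
  rw [contMDiffAt_iff_target]
  refine ⟨(D.isEmbedding_incl.continuous_iff.2 hf.continuous).continuousAt, ?_⟩
  have h1 : ContMDiffAt I 𝓘(ℝ, A) ω (fun y => D.incl (f x)⁻¹ * D.incl (f y)) x :=
    ((contDiff_const (c := D.incl (f x)⁻¹)).mul contDiff_id).contMDiff.contMDiffAt.comp x (hf x)
  have h2 : ContDiffAt ℝ ω (fun a : A => D.proj (D.logHomeo a))
      (D.incl (f x)⁻¹ * D.incl (f x)) := by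
    refine D.proj.contDiff.contDiffAt.comp _ (D.contDiffAt_logHomeo ?_)
    rw [← map_mul, inv_mul_cancel, map_one]
    exact D.one_mem_logHomeo_source
  refine (h2.contMDiffAt.comp x h1).congr_of_eventuallyEq (Eventually.of_forall fun y => ?_)
  change D.chart (f x) (f y) = _
  simp [chart_apply, map_mul]

lemma lieGroup :
    letI := D.chartedSpace
    LieGroup 𝓘(ℝ, E) ω G := by
  let _ := D.chartedSpace
  have := D.isManifold
  refine { contMDiff_mul := ?_, contMDiff_inv := ?_ }
  · apply D.contMDiff_of_incl_comp
    simp only [map_mul]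
    have h : ContMDiff (𝓘(ℝ, E).prod 𝓘(ℝ, E)) 𝓘(ℝ, A × A) ω
        (fun p : G × G => (D.incl p.1, D.incl p.2)) :=
      (D.contMDiff_incl.comp contMDiff_fst).prodMk_space (D.contMDiff_incl.comp contMDiff_snd)
    exact (contDiff_mul (𝕜 := ℝ) (𝔸 := A)).contMDiff.comp h
  · apply D.contMDiff_of_incl_comp
    have : (fun g : G => D.incl g⁻¹) = fun g => Ring.inverse (D.incl g) := by
      funext g
      have : D.incl g = ((Units.map D.incl (toUnits g) : Aˣ) : A) := rfl
      rw [this, Ring.inverse_unit, ← map_inv, ← map_inv]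
      rfl
    rw [this]
    intro g
    exact (contDiffAt_ringInverse ℝ (Units.map D.incl (toUnits g))).contMDiffAt.comp g
      (D.contMDiff_incl g)

end LinearGroupData
end LinearGroups

section MatrixExp

variable {𝕜 : Type*} [RCLike 𝕜] {n : Type*} [Fintype n] [DecidableEq n]

lemma hasDerivAt_det_exp_zero (X : Matrix n n 𝕜) :
    HasDerivAt (fun t : 𝕜 => (NormedSpace.exp (t • X)).det) X.trace 0 := by
  have hd : DifferentiableAt 𝕜 (fun M : Matrix n n 𝕜 => M.det) 1 := by
    simp only [Matrix.det_apply]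
    have hc : ∀ i j, Differentiable 𝕜 (fun M : Matrix n n 𝕜 => M i j) := fun i j =>
      (LinearMap.toContinuousLinearMap (Matrix.entryLinearMap 𝕜 𝕜 i j :
        Matrix n n 𝕜 →ₗ[𝕜] 𝕜)).differentiable
    refine (Differentiable.fun_sum fun σ _ => Differentiable.const_smul ?_ _).differentiableAt
    have h : ∀ s : Finset n, Differentiable 𝕜 fun M : Matrix n n 𝕜 => ∏ i ∈ s, M (σ i) i := by
      intro s
      induction s using Finset.induction_on with
      | empty => simp
      | insert a s ha ih =>
        simp only [Finset.prod_insert ha]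
        exact (hc (σ a) a).mul ih
    exact h _
  -- the derivative of `det` at `1` in the direction `X`
  have h1 : HasDerivAt (fun t : 𝕜 => (1 + t • X).det) X.trace 0 := by
    have h0 := fun t : 𝕜 => Matrix.det_one_add_smul t X
    have h2 : HasDerivAt (fun t : 𝕜 => X.trace * t) X.trace 0 := by
      simpa using (hasDerivAt_id (0 : 𝕜)).const_mul X.trace
    set p := (1 + (Polynomial.X : Polynomial 𝕜) • X.map Polynomial.C).det.divX.divX
    have h3 : HasDerivAt (fun t : 𝕜 => p.eval t * t ^ 2) 0 0 := by
      have h := (p.hasDerivAt (0 : 𝕜)).mul (hasDerivAt_pow 2 (0 : 𝕜))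
      have e : (Polynomial.derivative p).eval 0 * (0 : 𝕜) ^ 2 +
          p.eval 0 * ((2 : ℕ) * (0 : 𝕜) ^ (2 - 1)) = 0 := by simp
      rw [e] at h
      exact h
    have h9 := (h2.const_add 1).add h3
    rw [add_zero] at h9
    exact h9.congr_of_eventuallyEq (Eventually.of_forall h0)
  have h4 : HasDerivAt (fun t : 𝕜 => 1 + t • X) X 0 := by
    have h := (hasDerivAt_id (0 : 𝕜)).smul_const X
    rw [one_smul] at h
    exact h.const_add 1
  have h5 := hd.hasFDerivAt
  have h6 : fderiv 𝕜 (fun M : Matrix n n 𝕜 => M.det) 1 X = X.trace := by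
    have h5' : HasFDerivAt (fun M : Matrix n n 𝕜 => M.det)
      (fderiv 𝕜 (fun M : Matrix n n 𝕜 => M.det) 1) (1 + (0 : 𝕜) • X) := by simpa using h5
    exact (h5'.comp_hasDerivAt (0 : 𝕜) h4).unique h1
  have h7 : HasDerivAt (fun t : 𝕜 => NormedSpace.exp (t • X)) X 0 := by
    have h := hasDerivAt_exp_smul_const (𝕂 := 𝕜) X (0 : 𝕜)
    rw [zero_smul, NormedSpace.exp_zero, one_mul] at h
    exact h
  have h8 : HasFDerivAt (fun M : Matrix n n 𝕜 => M.det)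
      (fderiv 𝕜 (fun M : Matrix n n 𝕜 => M.det) 1) (NormedSpace.exp ((0 : 𝕜) • X)) := by
    simpa using h5
  have := h8.comp_hasDerivAt (0 : 𝕜) h7
  exact h6 ▸ this

lemma det_exp_eq (X : Matrix n n 𝕜) :
    (NormedSpace.exp X).det = NormedSpace.exp X.trace := by
  have hf : ∀ t : 𝕜, HasDerivAt (fun t : 𝕜 => (NormedSpace.exp (t • X)).det)
      ((NormedSpace.exp (t • X)).det * X.trace) t := by
    intro t
    have h0 := hasDerivAt_det_exp_zero X
    have h1 : HasDerivAt (fun s : 𝕜 => (NormedSpace.exp ((s - t) • X)).det) X.trace t := by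
      have h0' : HasDerivAt (fun t : 𝕜 => (NormedSpace.exp (t • X)).det) X.trace (t - t) := by
        simpa using h0
      exact h0'.comp_sub_const t t
    refine (h1.const_mul (NormedSpace.exp (t • X)).det).congr_of_eventuallyEq
      (Eventually.of_forall fun s => ?_)
    change _ = (NormedSpace.exp (t • X)).det * (NormedSpace.exp ((s - t) • X)).det
    rw [← Matrix.det_mul, ← Matrix.exp_add_of_commute, ← add_smul]
    · simp
    · exact (Commute.refl X).smul_left _ |>.smul_right _
  have hg : ∀ t : 𝕜, HasDerivAt (fun t : 𝕜 => NormedSpace.exp (t • (-X.trace)))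
      (NormedSpace.exp (t • (-X.trace)) * (-X.trace)) t := fun t =>
    hasDerivAt_exp_smul_const (𝕂 := 𝕜) (-X.trace) t
  have hfg : ∀ t : 𝕜, HasDerivAt (fun t : 𝕜 => (NormedSpace.exp (t • X)).det *
      NormedSpace.exp (t • (-X.trace))) 0 t := by
    intro t
    convert! (hf t).mul (hg t) using 1
    ring
  have hconst := is_const_of_deriv_eq_zero (fun t => (hfg t).differentiableAt)
    (fun t => (hfg t).deriv) 1 0
  have hinv : NormedSpace.exp (-X.trace) * NormedSpace.exp X.trace = 1 := by
    rw [← NormedSpace.exp_add, neg_add_cancel, NormedSpace.exp_zero]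
  simp only [one_smul, zero_smul, NormedSpace.exp_zero, Matrix.det_one, mul_one] at hconst
  calc (NormedSpace.exp X).det
      = (NormedSpace.exp X).det * (NormedSpace.exp (-X.trace) * NormedSpace.exp X.trace) := by
        rw [hinv, mul_one]
    _ = _ := by rw [← mul_assoc, hconst, one_mul]

end MatrixExp

section Model

variable {A : Type*} [NormedRing A] [NormedAlgebra ℝ A] [FiniteDimensional ℝ A]

/-- The space `ℝ^d`, `d = dim 𝔤`, on which a Lie group with Lie algebra `𝔤` is modelled. -/
abbrev LieModel {V : Type*} [AddCommGroup V] [Module ℝ V] (𝔤 : Submodule ℝ V) : Type :=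
  EuclideanSpace ℝ (Fin (Module.finrank ℝ 𝔤))

/-- A linear isomorphism of `ℝ^d` with `𝔤`. -/
def modelEquiv (𝔤 : Submodule ℝ A) : LieModel 𝔤 ≃L[ℝ] 𝔤 :=
  ContinuousLinearEquiv.ofFinrankEq (by simp)

/-- The linear embedding of `ℝ^d` in `A` with range `𝔤`. -/
def tangOf (𝔤 : Submodule ℝ A) : LieModel 𝔤 →L[ℝ] A :=
  𝔤.subtypeL.comp (modelEquiv 𝔤 : LieModel 𝔤 →L[ℝ] 𝔤)

lemma mem_range_tangOf (𝔤 : Submodule ℝ A) {X : A} : X ∈ range (tangOf 𝔤) ↔ X ∈ 𝔤 := by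
  constructor
  · rintro ⟨v, rfl⟩
    exact (modelEquiv 𝔤 v).2
  · intro h
    exact ⟨(modelEquiv 𝔤).symm ⟨X, h⟩, by simp [tangOf]⟩

lemma exists_proj (𝔤 : Submodule ℝ A) : ∃ π : A →L[ℝ] 𝔤, ∀ X : 𝔤, π X = X :=
  Submodule.ClosedComplemented.of_finiteDimensional 𝔤

/-- A linear left inverse of `tangOf 𝔤`. -/
def projOf (𝔤 : Submodule ℝ A) : A →L[ℝ] LieModel 𝔤 :=
  ((modelEquiv 𝔤).symm : 𝔤 →L[ℝ] LieModel 𝔤).comp (exists_proj 𝔤).choose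

lemma projOf_tangOf (𝔤 : Submodule ℝ A) (v : LieModel 𝔤) : projOf 𝔤 (tangOf 𝔤 v) = v := by
  have h := (exists_proj 𝔤).choose_spec (modelEquiv 𝔤 v)
  simp only [projOf, tangOf, ContinuousLinearMap.comp_apply, Submodule.subtypeL_apply,
    ContinuousLinearEquiv.coe_coe]
  rw [h, ContinuousLinearEquiv.symm_apply_apply]

end Model

section Groups

/-- The special linear group `SL(n, ℝ)`. -/
abbrev SLR (n : ℕ) : Type := Matrix.SpecialLinearGroup (Fin n) ℝ

/-- The Lie algebra `sl(n, ℝ)` of traceless matrices. -/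
abbrev slR (n : ℕ) : Submodule ℝ (Matrix (Fin n) (Fin n) ℝ) :=
  LinearMap.ker (Matrix.traceLinearMap (Fin n) ℝ ℝ)

/-- The Hermitian form `diag(1, …, 1, -1, …, -1)` of signature `(p, q)`. -/
def signatureForm (p q : ℕ) : Matrix (Fin (p + q)) (Fin (p + q)) ℂ :=
  Matrix.diagonal fun a => if (a : ℕ) < p then 1 else -1

/-- The special pseudo-unitary group `SU(p, q)`. -/
def SU (p q : ℕ) : Subgroup (Matrix.SpecialLinearGroup (Fin (p + q)) ℂ) where
  carrier := {g | (g : Matrix (Fin (p + q)) (Fin (p + q)) ℂ)ᴴ * signatureForm p q *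
    (g : Matrix (Fin (p + q)) (Fin (p + q)) ℂ) = signatureForm p q}
  one_mem' := by simp
  mul_mem' {g h} hg hh := by
    simp only [Set.mem_ofPred_eq, Matrix.SpecialLinearGroup.coe_mul, conjTranspose_mul] at hg hh ⊢
    calc _ = (h : Matrix (Fin (p + q)) (Fin (p + q)) ℂ)ᴴ *
          ((g : Matrix (Fin (p + q)) (Fin (p + q)) ℂ)ᴴ * signatureForm p q *
            (g : Matrix (Fin (p + q)) (Fin (p + q)) ℂ)) *
          (h : Matrix (Fin (p + q)) (Fin (p + q)) ℂ) := by simp only [Matrix.mul_assoc]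
      _ = _ := by rw [hg, hh]
  inv_mem' {g} hg := by
    simp only [Set.mem_ofPred_eq] at hg ⊢
    have h1 : (g : Matrix (Fin (p + q)) (Fin (p + q)) ℂ) *
        ((g⁻¹ : Matrix.SpecialLinearGroup (Fin (p + q)) ℂ) :
          Matrix (Fin (p + q)) (Fin (p + q)) ℂ) = 1 := by
      rw [← Matrix.SpecialLinearGroup.coe_mul, mul_inv_cancel, Matrix.SpecialLinearGroup.coe_one]
    set k := ((g⁻¹ : Matrix.SpecialLinearGroup (Fin (p + q)) ℂ) :
          Matrix (Fin (p + q)) (Fin (p + q)) ℂ)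
    have h2 : kᴴ * (g : Matrix (Fin (p + q)) (Fin (p + q)) ℂ)ᴴ = 1 := by
      rw [← conjTranspose_mul, h1, conjTranspose_one]
    calc kᴴ * signatureForm p q * k
        = kᴴ * ((g : Matrix (Fin (p + q)) (Fin (p + q)) ℂ)ᴴ * signatureForm p q *
            (g : Matrix (Fin (p + q)) (Fin (p + q)) ℂ)) * k := by rw [hg]
      _ = (kᴴ * (g : Matrix (Fin (p + q)) (Fin (p + q)) ℂ)ᴴ) * signatureForm p q *
            ((g : Matrix (Fin (p + q)) (Fin (p + q)) ℂ) * k) := by simp only [Matrix.mul_assoc]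
      _ = _ := by rw [h1, h2, one_mul, mul_one]

/-- The Lie algebra `su(p, q)`, a real vector space of complex matrices. -/
def su (p q : ℕ) : Submodule ℝ (Matrix (Fin (p + q)) (Fin (p + q)) ℂ) where
  carrier := {X | Xᴴ * signatureForm p q + signatureForm p q * X = 0 ∧ X.trace = 0}
  zero_mem' := by simp
  add_mem' {X Y} hX hY := by
    refine ⟨?_, by rw [Matrix.trace_add, hX.2, hY.2, add_zero]⟩
    have := congrArg₂ (· + ·) hX.1 hY.1
    simp only [add_zero] at this
    rw [← this, conjTranspose_add, add_mul, mul_add]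
    abel
  smul_mem' c X hX := by
    refine ⟨?_, by rw [Matrix.trace_smul, hX.2, smul_zero]⟩
    rw [conjTranspose_smul, star_trivial, smul_mul_assoc, mul_smul_comm, ← smul_add, hX.1,
      smul_zero]

lemma signatureForm_mul_self (p q : ℕ) : signatureForm p q * signatureForm p q = 1 := by
  rw [signatureForm, Matrix.diagonal_mul_diagonal, ← Matrix.diagonal_one]
  congr 1
  funext a
  split_ifs <;> simp

/-- The inclusion of `SL(n, ℝ)` in the real matrices. -/
def slIncl (n : ℕ) : SLR n →* Matrix (Fin n) (Fin n) ℝ where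
  toFun g := g
  map_one' := rfl
  map_mul' _ _ := rfl

/-- The inclusion of `SU(p, q)` in the complex matrices. -/
def suIncl (p q : ℕ) : SU p q →* Matrix (Fin (p + q)) (Fin (p + q)) ℂ where
  toFun g := (g : Matrix.SpecialLinearGroup (Fin (p + q)) ℂ)
  map_one' := rfl
  map_mul' _ _ := rfl

/-- `SL(n, ℝ)` as a group of matrices with Lie algebra `sl(n, ℝ)`. -/
def slData (n : ℕ) : LinearGroupData (SLR n) (Matrix (Fin n) (Fin n) ℝ) (LieModel (slR n)) where
  incl := slIncl n
  isEmbedding_incl := IsEmbedding.subtypeVal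
  tang := tangOf (slR n)
  proj := projOf (slR n)
  proj_tang := projOf_tangOf (slR n)
  exp_mem_iff := by
    refine Eventually.of_forall fun X => ?_
    have h1 : NormedSpace.exp X ∈ range (slIncl n) ↔ (NormedSpace.exp X).det = 1 :=
      ⟨fun ⟨g, hg⟩ => hg ▸ g.2, fun h => ⟨⟨_, h⟩, rfl⟩⟩
    have h2 : X ∈ slR n ↔ X.trace = 0 := by
      simp [slR]
    have h3 : (NormedSpace.exp X).det = 1 ↔ X.trace = 0 := by
      rw [det_exp_eq, ← Real.exp_eq_exp_ℝ, Real.exp_eq_one_iff]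
    exact h1.trans (h3.trans (h2.symm.trans (mem_range_tangOf (slR n)).symm))

lemma eventually_exp_eq_one_iff {A B : Type*} [NormedRing A] [NormedRing B] [NormedAlgebra ℝ B]
    [CompleteSpace B] (t : A → B) (ht : ContinuousAt t 0) (h0 : t 0 = 0) :
    ∀ᶠ X in 𝓝 (0 : A), NormedSpace.exp (t X) = 1 ↔ t X = 0 := by
  have e : ∀ᶠ X in 𝓝 (0 : A), t X ∈ (expLocal B).source :=
    ht.eventually_mem ((expLocal B).open_source.mem_nhds (by
      rw [h0]; exact zero_mem_expLocal_source))
  filter_upwards [e] with X hX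
  have := (expLocal B).injOn.eq_iff hX zero_mem_expLocal_source
  rwa [expLocal_coe, NormedSpace.exp_zero] at this

lemma eventually_exp_eq_exp_neg_iff {A : Type*} [NormedRing A] [NormedAlgebra ℝ A]
    [CompleteSpace A] (s : A → A) (hs : ContinuousAt s 0) (h0 : s 0 = 0) :
    ∀ᶠ X in 𝓝 (0 : A), NormedSpace.exp (s X) = NormedSpace.exp (-X) ↔ s X = -X := by
  have e : ∀ᶠ X in 𝓝 (0 : A), s X ∈ (expLocal A).source :=
    hs.eventually_mem ((expLocal A).open_source.mem_nhds (by
      rw [h0]; exact zero_mem_expLocal_source))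
  have e' : ∀ᶠ X in 𝓝 (0 : A), -X ∈ (expLocal A).source :=
    continuous_neg.continuousAt.eventually_mem ((expLocal A).open_source.mem_nhds (by
      rw [neg_zero]; exact zero_mem_expLocal_source))
  filter_upwards [e, e'] with X hX hX'
  exact (expLocal A).injOn.eq_iff hX hX'

lemma su_exp_mem_iff (p q : ℕ) :
    ∀ᶠ X in 𝓝 (0 : Matrix (Fin (p + q)) (Fin (p + q)) ℂ),
      NormedSpace.exp X ∈ range (suIncl p q) ↔ X ∈ su p q := by
  set S := signatureForm p q with hS
  have hSS : S * S = 1 := signatureForm_mul_self p q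
  have hSu : IsUnit S := ⟨⟨S, S, hSS, hSS⟩, rfl⟩
  have hSi : S⁻¹ = S := Matrix.inv_eq_left_inv hSS
  have e1 := eventually_exp_eq_exp_neg_iff
    (fun X : Matrix (Fin (p + q)) (Fin (p + q)) ℂ => S * Xᴴ * S)
    (Continuous.continuousAt (by
      exact (continuous_const.matrix_mul continuous_id.matrix_conjTranspose).matrix_mul
        continuous_const)) (by simp)
  have e3 := eventually_exp_eq_one_iff
    (fun X : Matrix (Fin (p + q)) (Fin (p + q)) ℂ => X.trace)
    (Continuous.continuousAt (by exact continuous_id.matrix_trace)) (by simp)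
  filter_upwards [e1, e3] with X h1 h3
  have hr : NormedSpace.exp X ∈ range (suIncl p q) ↔
      (NormedSpace.exp X)ᴴ * S * NormedSpace.exp X = S ∧ (NormedSpace.exp X).det = 1 := by
    constructor
    · rintro ⟨g, hg⟩
      rw [← hg]
      exact ⟨g.2, g.1.2⟩
    · rintro ⟨ha, hb⟩
      exact ⟨⟨⟨_, hb⟩, ha⟩, rfl⟩
  have hd : (NormedSpace.exp X).det = 1 ↔ X.trace = 0 := by
    rw [det_exp_eq]
    exact h3
  have hexp : NormedSpace.exp (S * Xᴴ * S) = S * (NormedSpace.exp X)ᴴ * S := by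
    have := Matrix.exp_conj S Xᴴ hSu
    rwa [hSi, Matrix.exp_conjTranspose] at this
  have hinv : NormedSpace.exp (-X) * NormedSpace.exp X = 1 := by
    rw [← Matrix.exp_add_of_commute _ _ ((Commute.refl X).neg_left), neg_add_cancel,
      NormedSpace.exp_zero]
  have hinv' : NormedSpace.exp X * NormedSpace.exp (-X) = 1 := by
    rw [← Matrix.exp_add_of_commute _ _ ((Commute.refl X).neg_right), add_neg_cancel,
      NormedSpace.exp_zero]
  have hu : (NormedSpace.exp X)ᴴ * S * NormedSpace.exp X = S ↔ Xᴴ * S + S * X = 0 := by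
    have a1 : (NormedSpace.exp X)ᴴ * S * NormedSpace.exp X = S ↔
        NormedSpace.exp (S * Xᴴ * S) = NormedSpace.exp (-X) := by
      rw [hexp]
      constructor
      · intro h
        calc S * (NormedSpace.exp X)ᴴ * S
            = S * ((NormedSpace.exp X)ᴴ * S * NormedSpace.exp X) * NormedSpace.exp (-X) := by
              simp only [Matrix.mul_assoc, hinv', Matrix.mul_one]
          _ = _ := by rw [h, hSS, Matrix.one_mul]
      · intro h
        calc (NormedSpace.exp X)ᴴ * S * NormedSpace.exp X
            = S * (S * (NormedSpace.exp X)ᴴ * S) * NormedSpace.exp X := by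
              simp only [← Matrix.mul_assoc, hSS, Matrix.one_mul]
          _ = _ := by rw [h, Matrix.mul_assoc, hinv, Matrix.mul_one]
    refine (a1.trans h1).trans ?_
    constructor
    · intro h
      have : S * (S * Xᴴ * S) = S * (-X) := by rw [h]
      simp only [← Matrix.mul_assoc, hSS, Matrix.one_mul, Matrix.mul_neg] at this
      rw [this, neg_add_cancel]
    · intro h
      rw [Matrix.mul_assoc, eq_neg_of_add_eq_zero_left h, Matrix.mul_neg, ← Matrix.mul_assoc, hSS,
        Matrix.one_mul]
  exact hr.trans (and_congr hu hd)

/-- `SU(p, q)` as a group of matrices with Lie algebra `su(p, q)`. -/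
def suData (p q : ℕ) : LinearGroupData (SU p q) (Matrix (Fin (p + q)) (Fin (p + q)) ℂ)
    (LieModel (su p q)) where
  incl := suIncl p q
  isEmbedding_incl := IsEmbedding.subtypeVal.comp IsEmbedding.subtypeVal
  tang := tangOf (su p q)
  proj := projOf (su p q)
  proj_tang := projOf_tangOf (su p q)
  exp_mem_iff := by
    filter_upwards [su_exp_mem_iff p q] with X hX
    exact hX.trans (mem_range_tangOf (su p q)).symm

instance (n : ℕ) : ChartedSpace (LieModel (slR n)) (SLR n) := (slData n).chartedSpace

instance (n : ℕ) : LieGroup 𝓘(ℝ, LieModel (slR n)) ω (SLR n) := (slData n).lieGroup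

instance (p q : ℕ) : ChartedSpace (LieModel (su p q)) (SU p q) := (suData p q).chartedSpace

instance (p q : ℕ) : LieGroup 𝓘(ℝ, LieModel (su p q)) ω (SU p q) := (suData p q).lieGroup

end Groups

section ComplexProductStructures

variable {E H : Type*} [NormedAddCommGroup E] [NormedSpace ℝ E] [TopologicalSpace H]
  (I : ModelWithCorners ℝ E H)

/-- A field of endomorphisms of the tangent spaces of a manifold. -/
abbrev TangentEnd (M : Type*) [TopologicalSpace M] [ChartedSpace H M] : Type _ :=
  ∀ x : M, TangentSpace I x →L[ℝ] TangentSpace I x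

variable {M : Type*} [TopologicalSpace M] [ChartedSpace H M]

/-- The field of endomorphisms is a smooth map `TM → TM`. -/
def IsSmoothEnd [IsManifold I 1 M] (P : TangentEnd I M) : Prop :=
  ContMDiff I.tangent I.tangent ∞
    (fun v : TangentBundle I M => (⟨v.proj, P v.proj v.2⟩ : TangentBundle I M))

/-- The vector field `X` is smooth. -/
def IsSmoothField [IsManifold I 1 M] (X : ∀ x : M, TangentSpace I x) : Prop :=
  ContMDiff I I.tangent ∞ (fun x => (⟨x, X x⟩ : TangentBundle I M))

open VectorField in
/-- The expression `[PX, PY] + ε [X, Y] - P [PX, Y] - P [X, PY]`, which is the Nijenhuis tensor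
of `P` for `ε = 1` if `P² = 1`, and for `ε = -1` if `P² = -1`. -/
def nijenhuis (ε : ℝ) (P : TangentEnd I M) (X Y : ∀ x : M, TangentSpace I x) (x : M) :
    TangentSpace I x :=
  mlieBracket I (fun y => P y (X y)) (fun y => P y (Y y)) x + ε • mlieBracket I X Y x
    - P x (mlieBracket I (fun y => P y (X y)) Y x) - P x (mlieBracket I X (fun y => P y (Y y)) x)

/-- An almost product structure: a smooth field of linear involutions of constant trace. -/
structure IsAlmostProductStructure [IsManifold I 1 M] (P : TangentEnd I M) : Prop where
  smooth : IsSmoothEnd I P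
  sq : ∀ x v, P x (P x v) = v
  trace_const : ∃ c : ℝ, ∀ x, LinearMap.trace ℝ (TangentSpace I x) (P x).toLinearMap = c

/-- A product structure: an integrable almost product structure. -/
structure IsProductStructure [IsManifold I 1 M] (P : TangentEnd I M) : Prop
    extends IsAlmostProductStructure I P where
  integrable : ∀ X Y : ∀ x : M, TangentSpace I x, IsSmoothField I X → IsSmoothField I Y →
    ∀ x, nijenhuis I 1 P X Y x = 0

/-- A complex structure: an integrable almost complex structure. -/
structure IsComplexStructure [IsManifold I 1 M] (J : TangentEnd I M) : Prop where
  smooth : IsSmoothEnd I J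
  sq : ∀ x v, J x (J x v) = -v
  integrable : ∀ X Y : ∀ x : M, TangentSpace I x, IsSmoothField I X → IsSmoothField I Y →
    ∀ x, nijenhuis I (-1) J X Y x = 0

/-- A complex product structure: a product structure and a complex structure that anticommute. -/
structure IsComplexProductStructure [IsManifold I 1 M] (P J : TangentEnd I M) : Prop where
  product : IsProductStructure I P
  complex : IsComplexStructure I J
  anticomm : ∀ x v, P x (J x v) = -J x (P x v)

/-- The field of endomorphisms commutes with the differentials of all left translations. -/
def IsLeftInvariant {G : Type*} [Group G] [TopologicalSpace G] [ChartedSpace H G]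
    (P : TangentEnd I G) : Prop :=
  ∀ (g h : G) (v : TangentSpace I h),
    mfderiv I I (fun x => g * x) h (P h v) = P (g * h) (mfderiv I I (fun x => g * x) h v)

end ComplexProductStructures

section MatrixBases

/-- The matrix unit with entry `1` in row `j` and column `k`, where the rows and columns are
numbered from `1` to `n`. -/
def mE {n : ℕ} {R : Type*} [Zero R] [One R] (j k : ℕ) : Matrix (Fin n) (Fin n) R :=
  Matrix.of fun a b => if (a : ℕ) + 1 = j ∧ (b : ℕ) + 1 = k then 1 else 0

/-- The indices `j` with `1 ≤ j ≤ m - 1` and the pairs `(j, k)` with `1 ≤ j ≤ m - 1` and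
`j < k < 2 m - j`. -/
abbrev BlockIndex (m : ℕ) : Type :=
  {j : ℕ // 1 ≤ j ∧ j ≤ m - 1} ⊕
    {p : ℕ × ℕ // (1 ≤ p.1 ∧ p.1 ≤ m - 1) ∧ p.1 < p.2 ∧ p.2 < 2 * m - p.1}

/-- The four members of each block of the bases. -/
inductive Letter : Type
  | U | V | S | T

/-- The basis of `sl(2m-1, ℝ)`. -/
def slElement (m : ℕ) : Letter → BlockIndex m → Matrix (Fin (2 * m - 1)) (Fin (2 * m - 1)) ℝ
  | .U, .inl ⟨j, _⟩ => mE j j + mE (2 * m - j) (2 * m - j) - (2 : ℝ) • mE m m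
  | .V, .inl ⟨j, _⟩ => mE j (2 * m - j) - mE (2 * m - j) j
  | .S, .inl ⟨j, _⟩ => mE j (2 * m - j) + mE (2 * m - j) j
  | .T, .inl ⟨j, _⟩ => mE j j - mE (2 * m - j) (2 * m - j)
  | .U, .inr ⟨(j, k), _⟩ => mE j k - mE k j
  | .V, .inr ⟨(j, k), _⟩ => mE k (2 * m - j) - mE (2 * m - j) k
  | .S, .inr ⟨(j, k), _⟩ => mE k (2 * m - j) + mE (2 * m - j) k
  | .T, .inr ⟨(j, k), _⟩ => mE j k + mE k j

/-- The basis of `su(m, m-1)`. -/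
def suElement (m : ℕ) :
    Letter → BlockIndex m → Matrix (Fin (m + (m - 1))) (Fin (m + (m - 1))) ℂ
  | .U, .inl ⟨j, _⟩ => Complex.I • (mE j j + mE (2 * m - j) (2 * m - j) - (2 : ℂ) • mE m m)
  | .V, .inl ⟨j, _⟩ => Complex.I • (mE j j - mE (2 * m - j) (2 * m - j))
  | .S, .inl ⟨j, _⟩ => mE j (2 * m - j) + mE (2 * m - j) j
  | .T, .inl ⟨j, _⟩ => Complex.I • (mE j (2 * m - j) - mE (2 * m - j) j)
  | .U, .inr ⟨(j, k), _⟩ =>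
      if k ≤ m then mE j k - mE k j else mE k (2 * m - j) - mE (2 * m - j) k
  | .V, .inr ⟨(j, k), _⟩ =>
      if k ≤ m then Complex.I • (mE j k + mE k j)
      else Complex.I • (mE k (2 * m - j) + mE (2 * m - j) k)
  | .S, .inr ⟨(j, k), _⟩ =>
      if k ≤ m then mE k (2 * m - j) + mE (2 * m - j) k else -mE j k - mE k j
  | .T, .inr ⟨(j, k), _⟩ =>
      if k ≤ m then Complex.I • (mE k (2 * m - j) - mE (2 * m - j) k)
      else Complex.I • (mE k j - mE j k)

/-- The differential at the identity of the inclusion of `G` in `A`, which identifies the Lie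
algebra of `G` with a space of elements of `A`. -/
def LinearGroupData.inclDeriv {G A F : Type*} [Group G] [TopologicalSpace G] [ContinuousMul G]
    [NormedRing A] [NormedAlgebra ℝ A] [CompleteSpace A] [NormedAddCommGroup F] [NormedSpace ℝ F]
    (D : LinearGroupData G A F) :
    letI := D.chartedSpace
    GroupLieAlgebra 𝓘(ℝ, F) G →L[ℝ] A :=
  letI := D.chartedSpace
  mfderiv 𝓘(ℝ, F) 𝓘(ℝ, A) D.incl (1 : G)

lemma LinearGroupData.inclDeriv_apply {G A F : Type*} [Group G] [TopologicalSpace G]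
    [ContinuousMul G] [NormedRing A] [NormedAlgebra ℝ A] [CompleteSpace A] [NormedAddCommGroup F]
    [NormedSpace ℝ F] (D : LinearGroupData G A F) (v : F) : D.inclDeriv v = D.tang v := by
  let _ := D.chartedSpace
  have := D.isManifold
  have h1 : MDifferentiableAt 𝓘(ℝ, F) 𝓘(ℝ, A) D.incl (1 : G) :=
    (D.contMDiff_incl 1).mdifferentiableAt (by simp)
  have h0 : extChartAt 𝓘(ℝ, F) (1 : G) 1 = 0 := by
    change D.proj (D.logHomeo (D.incl (1⁻¹ * 1))) = 0
    have h := D.logHomeo.right_inv (x := 0) (by rw [logHomeo_target]; exact D.zero_mem_nhd)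
    rw [D.logHomeo_symm_coe, NormedSpace.exp_zero] at h
    rw [inv_one, one_mul, map_one, h, map_zero]
  change mfderiv 𝓘(ℝ, F) 𝓘(ℝ, A) D.incl (1 : G) v = _
  rw [h1.mfderiv]
  simp only [modelWithCornersSelf_coe, range_id, fderivWithin_univ]
  have h2 : HasFDerivAt (fun X : F => NormedSpace.exp (D.tang X)) D.tang 0 := by
    have h3 : HasFDerivAt (NormedSpace.exp : A → A) (1 : A →L[ℝ] A) (D.tang 0) := by
      rw [map_zero]; exact hasFDerivAt_exp_zero
    exact h3.comp 0 D.tang.hasFDerivAt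
  have h4 : HasFDerivAt (writtenInExtChartAt 𝓘(ℝ, F) 𝓘(ℝ, A) (1 : G) D.incl) D.tang 0 := by
    refine h2.congr_of_eventuallyEq ?_
    have hn : D.tang ⁻¹' D.nhd ∈ 𝓝 (0 : F) :=
      (D.isOpen_nhd.preimage D.tang.continuous).mem_nhds (by
        rw [mem_preimage, map_zero]; exact D.zero_mem_nhd)
    filter_upwards [hn] with X hX
    change D.incl ((D.chart 1).symm X) = _
    rw [D.incl_chart_symm hX, map_one, one_mul]
  rw [h0, h4.fderiv]
  rfl

/-- The elements `e x β` form a basis of the Lie algebra of `G`, and `P` and `J` are given at the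
identity by `J U = V`, `J S = T`, `P U = T`, `P V = S` in each block `β`. -/
def HasBlockForm {G A F ι : Type*} [Group G] [TopologicalSpace G] [ContinuousMul G]
    [NormedRing A] [NormedAlgebra ℝ A] [CompleteSpace A] [NormedAddCommGroup F] [NormedSpace ℝ F]
    (D : LinearGroupData G A F) (e : Letter → ι → A) (P J : letI := D.chartedSpace
      TangentEnd 𝓘(ℝ, F) G) : Prop :=
  letI := D.chartedSpace
  ∃ b : Module.Basis (Letter × ι) ℝ (GroupLieAlgebra 𝓘(ℝ, F) G),
    (∀ x β, D.inclDeriv (b (x, β)) = e x β) ∧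
    ∀ β, J 1 (b (.U, β)) = b (.V, β) ∧ J 1 (b (.S, β)) = b (.T, β) ∧
      P 1 (b (.U, β)) = b (.T, β) ∧ P 1 (b (.V, β)) = b (.S, β)

end MatrixBases

end

/-! A left invariant field of endomorphisms is determined by its value on the Lie algebra, and
identities such as `P² = 1`, `J² = -1`, `PJ = -JP` are transported by left translations. Once `P²`
is a scalar, the Nijenhuis expression is tensorial, so it need only be tested on left invariant
vector fields (`nijenhuis_leftInvariantEnd_eq_zero`). There it is an identity in the Lie algebra,
whose bracket is the commutator of matrices (`LinearGroupData.inclDeriv_lie`). What remains is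
linear algebra.

Embed the Lie algebra real-linearly in the complex matrices and let `P² = c²`, with `c = 1` for `P`
and `c = i` for `J`. If all `cx + Px` lie in `Q` and all `cx - Px` in `R`, where `Q` and `R` are
complex subspaces closed under commutators with `Q ∩ R = 0`, then the Nijenhuis tensor lies in both,
hence vanishes (`IsLieSplitting.nijenhuis_eq_zero`).

Two such pairs suffice. The first consists of the upper and the lower triangular matrices of trace
`0` in which the diagonal entries at the opposite places `j` and `2m-j` satisfy a linear relation,
one for the upper and an independent one for the lower matrices. The two relations and the trace
condition leave no common diagonal matrix, since the size `2m-1` is odd and only the centre is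
unpaired (`isLieSplitting_triangularSubspace`). The second pair is conjugate to the first by `1 +
iw`, where `w` reverses the order of the basis (`cayley`). For `sl` the triangular pair handles `P`
and its conjugate handles `J`; for `su` it is the other way round. The memberships are short
computations with matrix units (`cayley_antisymm_add_mem` and its three companions,
`cayley_corner`).

That the listed matrices form bases rests on the fact that the blocks occupy each matrix position
other than the centre exactly once, while the trace determines the central entry (`blockPos_inj`,
`exists_blockPos_eq`, `eq_zero_of_entry_blockPos`). -/

noncomputable section

set_option linter.unusedSectionVars false

/-! ### Left invariant fields of endomorphisms on a Lie group -/

section LeftInvariant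

open Bundle VectorField

variable {E H : Type*} [NormedAddCommGroup E] [NormedSpace ℝ E] [TopologicalSpace H]
  {I : ModelWithCorners ℝ E H} {G : Type*} [Group G] [TopologicalSpace G] [ChartedSpace H G]

/-- The Maurer-Cartan form, which moves tangent vectors to the identity by left translations. -/
def maurerCartan (g : G) : TangentSpace I g →L[ℝ] GroupLieAlgebra I G :=
  (mfderiv I I (fun x => g⁻¹ * x) g : E →L[ℝ] E)

/-- The left invariant field of endomorphisms with value `P` at the identity. -/
def leftInvariantEnd (P : GroupLieAlgebra I G →L[ℝ] GroupLieAlgebra I G) : TangentEnd I G :=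
  fun g => ((mfderiv I I (fun x => g * x) (1 : G) : E →L[ℝ] E)).comp
    (P.comp (maurerCartan g) : E →L[ℝ] E)

lemma leftInvariantEnd_apply (P : GroupLieAlgebra I G →L[ℝ] GroupLieAlgebra I G) (g : G)
    (v : TangentSpace I g) :
    leftInvariantEnd P g v = mulInvariantVectorField (P (maurerCartan g v)) g := rfl

lemma mfderiv_one_mul (h : G) (v : E) :
    (mfderiv I I (fun x : G => 1 * x) h : E →L[ℝ] E) v = v := by
  have e : (fun x : G => 1 * x) = id := by ext x; simp
  rw [e, mfderiv_id]
  rfl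

variable [LieGroup I ω G]

lemma mdifferentiableAt_mul_left_apply (g h : G) : MDifferentiableAt I I (fun x => g * x) h :=
  (contMDiff_mul_left (I := I) (n := ω) (a := g)).contMDiffAt.mdifferentiableAt (by simp)

/-- Chain rule for `L_g ∘ L_h = L_{gh}`. The products enter through equations, and the derivatives
as maps of `E`, so that it applies where a product simplifies, as `g⁻¹ * g` to `1`, without
transport between tangent spaces. -/
lemma mfderiv_mul_left_mul {g h p k l : G} (hp : g * h = p) (hl : h * k = l) (v : E) :
    (mfderiv I I (fun x => g * x) l : E →L[ℝ] E)
      ((mfderiv I I (fun x => h * x) k : E →L[ℝ] E) v) =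
      (mfderiv I I (fun x => p * x) k : E →L[ℝ] E) v := by
  subst hp hl
  have e : (fun x => g * h * x) = (fun x => g * x) ∘ (fun x => h * x) := by
    ext x; simp [mul_assoc]
  rw [e, mfderiv_comp k (mdifferentiableAt_mul_left_apply g _)
    (mdifferentiableAt_mul_left_apply h k)]
  rfl

lemma maurerCartan_mulInvariantVectorField (g : G) (v : GroupLieAlgebra I G) :
    maurerCartan g (mulInvariantVectorField v g) = v :=
  (mfderiv_mul_left_mul (E := E) (inv_mul_cancel g) (mul_one g) v).trans
    (mfderiv_one_mul (E := E) _ _)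

lemma mulInvariantVectorField_maurerCartan (g : G) (v : TangentSpace I g) :
    mulInvariantVectorField (maurerCartan g v) g = v :=
  (mfderiv_mul_left_mul (E := E) (mul_inv_cancel g) (inv_mul_cancel g) v).trans
    (mfderiv_one_mul (E := E) _ _)

lemma maurerCartan_mul (g h : G) (v : TangentSpace I h) :
    maurerCartan (g * h) (mfderiv I I (fun x => g * x) h v) = maurerCartan h v :=
  mfderiv_mul_left_mul (E := E) (by simp) rfl v

lemma mfderiv_mul_left_mulInvariantVectorField (g h : G) (v : GroupLieAlgebra I G) :
    mfderiv I I (fun x => g * x) h (mulInvariantVectorField v h) =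
      mulInvariantVectorField v (g * h) :=
  mfderiv_mul_left_mul (E := E) rfl (mul_one h) v

lemma leftInvariantEnd_mulInvariantVectorField
    (P : GroupLieAlgebra I G →L[ℝ] GroupLieAlgebra I G) (v : GroupLieAlgebra I G) (g : G) :
    leftInvariantEnd P g (mulInvariantVectorField v g) = mulInvariantVectorField (P v) g := by
  rw [leftInvariantEnd_apply, maurerCartan_mulInvariantVectorField]

lemma isLeftInvariant_leftInvariantEnd (P : GroupLieAlgebra I G →L[ℝ] GroupLieAlgebra I G) :
    IsLeftInvariant I (leftInvariantEnd P) := by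
  intro g h v
  rw [leftInvariantEnd_apply, leftInvariantEnd_apply, maurerCartan_mul,
    mfderiv_mul_left_mulInvariantVectorField]

lemma leftInvariantEnd_one (P : GroupLieAlgebra I G →L[ℝ] GroupLieAlgebra I G)
    (v : GroupLieAlgebra I G) : leftInvariantEnd P (1 : G) v = P v := by
  have h : ∀ w : GroupLieAlgebra I G, mulInvariantVectorField w (1 : G) = w :=
    fun w => mfderiv_one_mul (E := E) _ _
  conv_lhs => rw [← h v, leftInvariantEnd_mulInvariantVectorField, h]

lemma leftInvariantEnd_leftInvariantEnd
    (P Q : GroupLieAlgebra I G →L[ℝ] GroupLieAlgebra I G) (g : G) (v : TangentSpace I g) :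
    leftInvariantEnd P g (leftInvariantEnd Q g v) =
      mulInvariantVectorField (P (Q (maurerCartan g v))) g := by
  rw [leftInvariantEnd_apply Q, leftInvariantEnd_mulInvariantVectorField]


lemma trivializationAt_mk_snd [IsManifold I 1 G] (x : G) (w : E) :
    (trivializationAt E (TangentSpace I) x (⟨x, w⟩ : TangentBundle I G)).2 = w :=
  (tangentBundleCore I G).coordChange_self (achart H x) x (mem_achart_source H x) w

lemma mk_eq_of_eq {x y : G} (h : x = y) (w : E) :
    (⟨x, w⟩ : TangentBundle I G) = ⟨y, w⟩ := by
  rw [h]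

lemma contMDiff_mk_one : ContMDiff 𝓘(ℝ, E) I.tangent ω
    (fun w : E => (⟨1, w⟩ : TangentBundle I G)) := by
  intro w
  rw [contMDiffAt_totalSpace]
  refine ⟨contMDiffAt_const, ?_⟩
  refine contMDiffAt_id.congr_of_eventuallyEq (Eventually.of_forall fun x => ?_)
  exact trivializationAt_mk_snd 1 x

/-- The trivialization at `1` is the identity on the fibre over `1`, so a smooth map into that fibre
is smooth as a map to `E`. -/
lemma ContMDiff.snd_of_proj_eq_one {N E' H' : Type*} [NormedAddCommGroup E'] [NormedSpace ℝ E']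
    [TopologicalSpace H'] {I' : ModelWithCorners ℝ E' H'} [TopologicalSpace N] [ChartedSpace H' N]
    {f : N → E} (hf : ContMDiff I' I.tangent ω (fun x => (⟨1, f x⟩ : TangentBundle I G))) :
    ContMDiff I' 𝓘(ℝ, E) ω f := by
  intro x
  have h := contMDiffAt_totalSpace.1 (hf x)
  refine h.2.congr_of_eventuallyEq (Eventually.of_forall fun x => ?_)
  exact (trivializationAt_mk_snd 1 (f x)).symm

lemma tangentMap_mul_apply (g h : G) (w : E) :
    tangentMap (I.prod I) I (fun p : G × G => p.1 * p.2)
      ((equivTangentBundleProd I G I G).symm (⟨g, (0 : E)⟩, ⟨h, w⟩)) =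
      ⟨g * h, (mfderiv I I (fun x => g * x) h : E →L[ℝ] E) w⟩ := by
  have M : MDifferentiableAt (I.prod I) I (fun p : G × G => p.1 * p.2) (g, h) :=
    (contMDiff_mul I ω).mdifferentiable (by simp) _
  have h1 := mfderiv_prod_eq_add_apply M (v := ((0 : E), w))
  have h2 : (mfderiv (I.prod I) I (fun p : G × G => p.1 * p.2) (g, h) : E × E →L[ℝ] E) (0, w) =
      (mfderiv I I (fun x => g * x) h : E →L[ℝ] E) w := by
    refine h1.trans ?_
    refine (congrArg (· + _) (map_zero (mfderiv I I (fun z : G => z * h) g : E →L[ℝ] E))).trans ?_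
    exact zero_add _
  exact congrArg (fun z : E => (⟨g * h, z⟩ : TangentBundle I G)) h2

/-- Smoothness jointly in the translating element and the tangent vector: the translate is the
tangent map of the multiplication `G × G → G` at the pair of a zero vector over `f x` and the vector
`g x`. -/
lemma contMDiff_tangentMap_mul {N E' H' : Type*} [NormedAddCommGroup E'] [NormedSpace ℝ E']
    [TopologicalSpace H'] {I' : ModelWithCorners ℝ E' H'} [TopologicalSpace N] [ChartedSpace H' N]
    {f : N → G} {g : N → TangentBundle I G} (hf : ContMDiff I' I ω f)
    (hg : ContMDiff I' I.tangent ω g) :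
    ContMDiff I' I.tangent ω (fun x => (⟨f x * (g x).proj,
      mfderiv I I (fun y => f x * y) (g x).proj (g x).2⟩ : TangentBundle I G)) := by
  have sf : ContMDiff I' I.tangent ω (fun x => (⟨f x, (0 : E)⟩ : TangentBundle I G)) :=
    (contMDiff_zeroSection ℝ (TangentSpace I : G → Type _)).comp hf
  have S₂ := (contMDiff_equivTangentBundleProd_symm (I := I) (M := G) (I' := I) (M' := G)
    (n := ω)).comp (sf.prodMk hg)
  have S₃ : ContMDiff (I.prod I).tangent I.tangent ω
      (tangentMap (I.prod I) I (fun p : G × G => p.1 * p.2)) :=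
    ContMDiff.contMDiff_tangentMap (m := ω) (contMDiff_mul I ω) le_rfl
  exact (S₃.comp S₂).congr fun x =>
    (tangentMap_mul_apply (I := I) (f x) (g x).proj (g x).2).symm

/-- The field moves `v` to the identity, applies a fixed linear map of `E`, and moves back; both
translations depend smoothly on `v` by `contMDiff_tangentMap_mul`. -/
lemma isSmoothEnd_leftInvariantEnd (P : GroupLieAlgebra I G →L[ℝ] GroupLieAlgebra I G) :
    IsSmoothEnd I (leftInvariantEnd P) := by
  let θ : TangentBundle I G → E := fun v => maurerCartan v.proj v.2
  have h1 : ContMDiff I.tangent 𝓘(ℝ, E) ω θ := by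
    apply ContMDiff.snd_of_proj_eq_one (I := I) (G := G)
    exact (contMDiff_tangentMap_mul
      ((contMDiff_inv I ω).comp (contMDiff_proj (TangentSpace I : G → Type _)))
      (contMDiff_id (I := I.tangent) (M := TangentBundle I G))).congr fun v =>
        mk_eq_of_eq (inv_mul_cancel _).symm _
  let P' : E →L[ℝ] E := P
  have h2 : ContMDiff 𝓘(ℝ, E) 𝓘(ℝ, E) ω P' := P'.contDiff.contMDiff
  have h3 := contMDiff_tangentMap_mul (I := I) (G := G) (contMDiff_proj (TangentSpace I : G → Type
      _))
    (contMDiff_mk_one.comp (h2.comp h1))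
  refine ContMDiff.of_le (n := ω) ?_ (by simp)
  exact h3.congr fun v => mk_eq_of_eq (mul_one _).symm _

lemma IsSmoothEnd.mdifferentiableAt_apply {M : Type*} [TopologicalSpace M] [ChartedSpace H M]
    [IsManifold I 1 M] {P : TangentEnd I M} (hP : IsSmoothEnd I P)
    {X : ∀ x : M, TangentSpace I x} {x : M}
    (hX : MDifferentiableAt I I.tangent (fun x => (⟨x, X x⟩ : TangentBundle I M)) x) :
    MDifferentiableAt I I.tangent (fun x => (⟨x, P x (X x)⟩ : TangentBundle I M)) x :=
  (hP.mdifferentiable (by simp) _).comp x hX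

lemma nijenhuis_swap {M : Type*} [TopologicalSpace M] [ChartedSpace H M] (ε : ℝ)
    (P : TangentEnd I M) (X Y : ∀ x : M, TangentSpace I x) (x : M) :
    nijenhuis I ε P X Y x = -nijenhuis I ε P Y X x := by
  unfold nijenhuis
  rw [mlieBracket_swap_apply (V := fun y => P y (X y)) (W := fun y => P y (Y y)),
    mlieBracket_swap_apply (V := X) (W := Y),
    mlieBracket_swap_apply (V := fun y => P y (X y)) (W := Y),
    mlieBracket_swap_apply (V := X) (W := fun y => P y (Y y))]
  simp only [map_neg, smul_neg]
  abel

/-- When `X` is replaced by `f X`, the terms containing `df(PY)` cancel directly, and those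
containing `df(Y)` cancel because `P² = ε`. -/
lemma tensorialAt_nijenhuis_left {M : Type*} [TopologicalSpace M] [ChartedSpace H M]
    [IsManifold I 1 M] [IsManifold I 2 M] [CompleteSpace E] {ε : ℝ} {P : TangentEnd I M}
    (hP : IsSmoothEnd I P) (hsq : ∀ x v, P x (P x v) = ε • v) (x : M)
    (Y : ∀ x : M, TangentSpace I x) :
    TensorialAt I E (fun X => nijenhuis I ε P X Y x) x where
  smul {f X} hf hX := by
    have hPX := hP.mdifferentiableAt_apply hX
    have e : (fun y => P y ((f • X) y)) = f • fun y => P y (X y) := by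
      ext y; simp
    simp only [nijenhuis]
    rw [e, mlieBracket_smul_left hf hX, mlieBracket_smul_left hf hX,
      mlieBracket_smul_left hf hPX, mlieBracket_smul_left hf hPX]
    simp only [map_add, map_smul, hsq]
    module
  add {X X'} hX hX' := by
    have hPX := hP.mdifferentiableAt_apply hX
    have hPX' := hP.mdifferentiableAt_apply hX'
    have e : (fun y => P y ((X + X') y)) = (fun y => P y (X y)) + fun y => P y (X' y) := by
      ext y; simp
    simp only [nijenhuis]
    rw [e, mlieBracket_add_left hX hX', mlieBracket_add_left hX hX',
      mlieBracket_add_left hPX hPX', mlieBracket_add_left hPX hPX']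
    simp only [map_add]
    module

/-- The Nijenhuis tensor of a left invariant field of endomorphisms vanishes if it vanishes on the
Lie algebra. -/
lemma nijenhuis_leftInvariantEnd_eq_zero [FiniteDimensional ℝ E] {ε : ℝ}
    {P : GroupLieAlgebra I G →L[ℝ] GroupLieAlgebra I G} (hsq : ∀ v, P (P v) = ε • v)
    (hN : ∀ u v, ⁅P u, P v⁆ + ε • ⁅u, v⁆ - P ⁅P u, v⁆ - P ⁅u, P v⁆ = 0)
    {X Y : ∀ g : G, TangentSpace I g} (hX : IsSmoothField I X) (hY : IsSmoothField I Y) (g : G) :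
    nijenhuis I ε (leftInvariantEnd P) X Y g = 0 := by
  have : CompleteSpace E := FiniteDimensional.complete ℝ E
  have hP := isSmoothEnd_leftInvariantEnd P
  have hsq' : ∀ (x : G) v, leftInvariantEnd P x (leftInvariantEnd P x v) = ε • v := by
    intro x v
    rw [leftInvariantEnd_leftInvariantEnd, hsq, mulInvariantVectorField_smul]
    exact congrArg (ε • ·) (mulInvariantVectorField_maurerCartan x v)
  -- By tensoriality `X` and `Y` may be replaced by the left invariant fields with the same values
  -- at `g`. Tensoriality in the second argument follows from that in the first by antisymmetry.
  have key := TensorialAt.pointwise₂ (I := I) (F := E) (F' := E)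
    (Φ := fun X Y => nijenhuis I ε (leftInvariantEnd P) X Y g) (x := g)
    (σ := X) (τ := Y) (σ' := mulInvariantVectorField (maurerCartan g (X g)))
    (τ' := mulInvariantVectorField (maurerCartan g (Y g)))
    (fun Y _ => tensorialAt_nijenhuis_left hP hsq' g Y)
    (fun X _ => by
      have h := tensorialAt_nijenhuis_left hP hsq' g X
      refine ⟨fun hf hY => ?_, fun hY hY' => ?_⟩
      · have h1 := h.smul hf hY
        simp only [nijenhuis_swap (X := X)] at h1 ⊢
        rw [h1, smul_neg]
      · have h1 := h.add hY hY'
        simp only [nijenhuis_swap (X := X)] at h1 ⊢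
        rw [h1, neg_add])
    (hX.mdifferentiableAt (by simp)) (mdifferentiableAt_mulInvariantVectorField _)
    (hY.mdifferentiableAt (by simp)) (mdifferentiableAt_mulInvariantVectorField _)
    (mulInvariantVectorField_maurerCartan g _).symm
    (mulInvariantVectorField_maurerCartan g _).symm
  refine key.trans ?_
  have hb : ∀ u v : GroupLieAlgebra I G, mlieBracket I (mulInvariantVectorField u)
      (mulInvariantVectorField v) g = mulInvariantVectorField ⁅u, v⁆ g := fun u v => by
    rw [GroupLieAlgebra.bracket_def, mulInvariantVector_mlieBracket]
  set u := maurerCartan g (X g)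
  set v := maurerCartan g (Y g)
  have h0 : ∀ w : GroupLieAlgebra I G, (fun y => leftInvariantEnd P y (mulInvariantVectorField w y))
      = mulInvariantVectorField (P w) := fun w => by
    ext y; exact leftInvariantEnd_mulInvariantVectorField P w y
  simp only [nijenhuis]
  rw [h0, h0, hb, hb, hb, hb, leftInvariantEnd_mulInvariantVectorField,
    leftInvariantEnd_mulInvariantVectorField]
  have hlin := (mfderiv I I (fun x => g * x) (1 : G) : E →L[ℝ] E).map_zero
  have h3 := congrArg (mfderiv I I (fun x => g * x) (1 : G) : E →L[ℝ] E) (hN u v)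
  rw [hlin] at h3
  have hL : ∀ (L : E →L[ℝ] E) (a b c d : E),
      L a + ε • L b - L c - L d = L (a + ε • b - c - d) := fun L a b c d => by simp
  exact (hL (mfderiv I I (fun x => g * x) (1 : G)) _ _ _ _).trans h3

/-- A complex product structure on a Lie algebra extends to a left invariant complex product
structure on the Lie group. -/
lemma isComplexProductStructure_leftInvariantEnd [FiniteDimensional ℝ E]
    {P J : GroupLieAlgebra I G →L[ℝ] GroupLieAlgebra I G} (hP : ∀ v, P (P v) = v)
    (hJ : ∀ v, J (J v) = -v) (hPJ : ∀ v, P (J v) = -J (P v))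
    (hNP : ∀ u v, ⁅P u, P v⁆ + (1 : ℝ) • ⁅u, v⁆ - P ⁅P u, v⁆ - P ⁅u, P v⁆ = 0)
    (hNJ : ∀ u v, ⁅J u, J v⁆ + (-1 : ℝ) • ⁅u, v⁆ - J ⁅J u, v⁆ - J ⁅u, J v⁆ = 0) :
    IsComplexProductStructure I (leftInvariantEnd P : TangentEnd I G) (leftInvariantEnd J) := by
  have sqP : ∀ (x : G) v, leftInvariantEnd P x (leftInvariantEnd P x v) = v := fun x v => by
    rw [leftInvariantEnd_leftInvariantEnd, hP, mulInvariantVectorField_maurerCartan]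
  have hneg : ∀ (x : G) (v : GroupLieAlgebra I G),
      mulInvariantVectorField (-v) x = -mulInvariantVectorField v x := fun x v =>
    (mfderiv I I (fun y => x * y) (1 : G) : E →L[ℝ] E).map_neg v
  have sqJ : ∀ (x : G) v, leftInvariantEnd J x (leftInvariantEnd J x v) = -v := fun x v => by
    rw [leftInvariantEnd_leftInvariantEnd, hJ, hneg, mulInvariantVectorField_maurerCartan]
  have anti : ∀ (x : G) v, leftInvariantEnd P x (leftInvariantEnd J x v) =
      -leftInvariantEnd J x (leftInvariantEnd P x v) := fun x v => by
    rw [leftInvariantEnd_leftInvariantEnd, leftInvariantEnd_leftInvariantEnd, hPJ, hneg]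
  refine ⟨⟨⟨isSmoothEnd_leftInvariantEnd P, sqP, 0, fun x => ?_⟩, fun X Y hX hY x => ?_⟩,
    ⟨isSmoothEnd_leftInvariantEnd J, sqJ, fun X Y hX hY x => ?_⟩, anti⟩
  -- The trace of `P` is `0`: anticommutation gives `J(PJ) = P` and `(PJ)J = -P`, and these two
  -- products have the same trace.
  · set p : TangentSpace I x →ₗ[ℝ] TangentSpace I x := (leftInvariantEnd P x).toLinearMap
    set j : TangentSpace I x →ₗ[ℝ] TangentSpace I x := (leftInvariantEnd J x).toLinearMap
    have h1 : j * (p * j) = p := by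
      ext v
      change leftInvariantEnd J x (leftInvariantEnd P x (leftInvariantEnd J x v)) = _
      rw [anti, map_neg, sqJ, neg_neg]
      rfl
    have h2 : (p * j) * j = -p := by
      ext v
      change leftInvariantEnd P x (leftInvariantEnd J x (leftInvariantEnd J x v)) = _
      rw [sqJ, map_neg]
      rfl
    have h3 := LinearMap.trace_mul_comm ℝ j (p * j)
    rw [h1, h2, map_neg] at h3
    linarith
  · exact nijenhuis_leftInvariantEnd_eq_zero (fun v => by rw [hP, one_smul]) hNP hX hY x
  · exact nijenhuis_leftInvariantEnd_eq_zero (fun v => by rw [hJ, neg_one_smul]) hNJ hX hY x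

end LeftInvariant

/-! ### The Lie bracket of a linear group is the commutator of matrices -/

section LieAlgebra

open VectorField

/-- Differentiate `dφ(V) = φ a` along `W` and `dφ(W) = φ b` along `V` and subtract: the second
derivatives of `φ` cancel by symmetry. The hypotheses say that `V` and `W` look like left invariant
fields through `φ`. -/
lemma fderiv_lieBracket_of_fderiv_apply_eq_mul {A F : Type*} [NormedRing A] [NormedAlgebra ℝ A]
    [NormedAddCommGroup F] [NormedSpace ℝ F] {φ : F → A} {x : F} (hφ : ContDiffAt ℝ 2 φ x)
    {V W : F → F} (hV : DifferentiableAt ℝ V x) (hW : DifferentiableAt ℝ W x) {a b : A}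
    (ha : ∀ᶠ y in 𝓝 x, fderiv ℝ φ y (V y) = φ y * a)
    (hb : ∀ᶠ y in 𝓝 x, fderiv ℝ φ y (W y) = φ y * b) :
    fderiv ℝ φ x (lieBracket ℝ V W x) =
      fderiv ℝ φ x (V x) * b - fderiv ℝ φ x (W x) * a := by
  have hd : DifferentiableAt ℝ (fderiv ℝ φ) x :=
    (hφ.fderiv_right (m := 1) (by norm_num)).differentiableAt (by simp)
  have key : ∀ {V : F → F} {a : A}, DifferentiableAt ℝ V x →
      (∀ᶠ y in 𝓝 x, fderiv ℝ φ y (V y) = φ y * a) → ∀ w,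
      fderiv ℝ (fderiv ℝ φ) x w (V x) + fderiv ℝ φ x (fderiv ℝ V x w) = fderiv ℝ φ x w * a := by
    intro V a hV ha w
    have h1 := hd.hasFDerivAt.clm_apply hV.hasFDerivAt
    have h2 := ((hφ.differentiableAt (by simp)).hasFDerivAt.mul_const' a).congr_of_eventuallyEq ha
    have h3 := DFunLike.congr_fun (h1.unique h2) w
    simp at h3
    rw [← h3, add_comm]
  have hs : IsSymmSndFDerivAt ℝ φ x := hφ.isSymmSndFDerivAt (by simp)
  rw [lieBracket, map_sub, ← key hV ha, ← key hW hb, hs.eq (V x) (W x)]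
  abel

/-- The tangent space at `x` is identified with `F` by the preferred chart at `x`, whose
differential at `x` is therefore the identity. -/
lemma mlieBracket_eq_lieBracket {F M : Type*} [NormedAddCommGroup F] [NormedSpace ℝ F]
    [TopologicalSpace M] [ChartedSpace F M] [IsManifold 𝓘(ℝ, F) 1 M]
    (V W : ∀ x : M, TangentSpace 𝓘(ℝ, F) x) (x : M) :
    (mlieBracket 𝓘(ℝ, F) V W x : F) = lieBracket ℝ
      (mpullbackWithin 𝓘(ℝ, F) 𝓘(ℝ, F) (extChartAt 𝓘(ℝ, F) x).symm V univ : F → F)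
      (mpullbackWithin 𝓘(ℝ, F) 𝓘(ℝ, F) (extChartAt 𝓘(ℝ, F) x).symm W univ : F → F)
      (extChartAt 𝓘(ℝ, F) x x) := by
  have h : (mfderiv 𝓘(ℝ, F) 𝓘(ℝ, F) (extChartAt 𝓘(ℝ, F) x) x : F →L[ℝ] F) =
      ContinuousLinearMap.id ℝ F := mfderiv_extChartAt_self
  have h' : ∀ (L : F →L[ℝ] F) (w : F), L = ContinuousLinearMap.id ℝ F → L.inverse w = w := by
    rintro _ w rfl
    rw [ContinuousLinearMap.inverse_id, ContinuousLinearMap.id_apply]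
  rw [← mlieBracketWithin_univ, mlieBracketWithin_apply]
  refine (h' _ _ h).trans ?_
  simp only [modelWithCornersSelf_coe, range_id, preimage_univ, univ_inter]
  exact congrFun lieBracketWithin_univ _

namespace LinearGroupData

variable {A : Type*} [NormedRing A] [NormedAlgebra ℝ A] [CompleteSpace A]
  {G : Type*} [Group G] [TopologicalSpace G] [ContinuousMul G] {F : Type*}
  [NormedAddCommGroup F] [NormedSpace ℝ F] (D : LinearGroupData G A F)

/-- Since the inclusion is multiplicative, it turns left translation by `g` into multiplication by
the matrix of `g`, which is linear; differentiate at `1`. -/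
lemma mfderiv_incl_mulInvariantVectorField (g : G) (u : F) :
    letI := D.chartedSpace
    (mfderiv 𝓘(ℝ, F) 𝓘(ℝ, A) D.incl g : F →L[ℝ] A)
      (mulInvariantVectorField (I := 𝓘(ℝ, F)) (G := G) u g) = D.incl g * D.tang u := by
  let _ := D.chartedSpace
  have := D.lieGroup
  have hi : ∀ h : G, MDifferentiableAt 𝓘(ℝ, F) 𝓘(ℝ, A) D.incl h := fun h =>
    (D.contMDiff_incl h).mdifferentiableAt (by simp)
  have e : D.incl ∘ (fun x => g * x) = (fun a => D.incl g * a) ∘ D.incl := by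
    ext x; simp
  have h1 := mfderiv_comp (I := 𝓘(ℝ, F)) (I' := 𝓘(ℝ, F)) (I'' := 𝓘(ℝ, A)) (1 : G)
    (hi (g * 1)) (mdifferentiableAt_mul_left_apply g 1)
  have hm : HasFDerivAt (fun a => D.incl g * a) (ContinuousLinearMap.mul ℝ A (D.incl g))
      (D.incl 1) := (ContinuousLinearMap.mul ℝ A (D.incl g)).hasFDerivAt
  have h2 := mfderiv_comp (I := 𝓘(ℝ, F)) (I' := 𝓘(ℝ, A)) (I'' := 𝓘(ℝ, A)) (1 : G)
    hm.hasMFDerivAt.mdifferentiableAt (hi 1)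
  rw [e, h2, hm.hasMFDerivAt.mfderiv] at h1
  have h3 := DFunLike.congr_fun h1 u
  have h4 := D.inclDeriv_apply u
  refine Eq.trans ?_ (h3.symm.trans (congrArg (D.incl g * ·) h4))
  have : ∀ (k : G) (hk : g = k) (w : F), (mfderiv 𝓘(ℝ, F) 𝓘(ℝ, A) D.incl g : F →L[ℝ] A) w =
      (mfderiv 𝓘(ℝ, F) 𝓘(ℝ, A) D.incl k : F →L[ℝ] A) w := by
    rintro k rfl w; rfl
  exact this (g * 1) (mul_one g).symm _

lemma chart_one_one : D.chart 1 1 = 0 := by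
  have h := D.logHomeo.right_inv (x := 0) (by rw [logHomeo_target]; exact D.zero_mem_nhd)
  rw [D.logHomeo_symm_coe, NormedSpace.exp_zero] at h
  rw [chart_apply, inv_one, one_mul, map_one, h, map_zero]

/-- The differential of the inclusion maps the Lie bracket to the commutator. -/
lemma inclDeriv_lie [FiniteDimensional ℝ F] :
    letI := D.chartedSpace
    ∀ u v : GroupLieAlgebra 𝓘(ℝ, F) G,
      D.inclDeriv ⁅u, v⁆ = D.inclDeriv u * D.inclDeriv v - D.inclDeriv v * D.inclDeriv u := by
  let _ := D.chartedSpace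
  have := D.lieGroup
  have hmf := D.isManifold
  intro u v
  have : CompleteSpace F := FiniteDimensional.complete ℝ F
  have h0 : extChartAt 𝓘(ℝ, F) (1 : G) 1 = 0 := D.chart_one_one
  let φ : F → A := fun Y => NormedSpace.exp (D.tang Y)
  let e := extChartAt 𝓘(ℝ, F) (1 : G)
  -- The left invariant field of `u` read in the logarithmic chart at `1`. In this chart the
  -- inclusion is `φ = exp ∘ tang`.
  let W : F → F → F := fun u =>
    mpullbackWithin 𝓘(ℝ, F) 𝓘(ℝ, F) e.symm (mulInvariantVectorField (I := 𝓘(ℝ, F)) (G := G) u)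
      univ
  have hWd : ∀ u, DifferentiableAt ℝ (W u) 0 := by
    intro u
    have := (mdifferentiableAt_mulInvariantVectorField (I := 𝓘(ℝ, F)) (G := G) u
      (g := 1)).mdifferentiableWithinAt (s := univ)
      |>.differentiableWithinAt_mpullbackWithin_vectorField
    rw [h0, preimage_univ, univ_inter, modelWithCornersSelf_coe, range_id] at this
    exact differentiableWithinAt_univ.1 this
  have hW : ∀ u, ∀ᶠ Y in 𝓝 (0 : F), fderiv ℝ φ Y (W u Y) = φ Y * D.tang u := by
    intro u
    filter_upwards [(D.isOpen_nhd.preimage D.tang.continuous).mem_nhds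
      (by rw [mem_preimage, map_zero]; exact D.zero_mem_nhd)] with Y hY
    have hYt : Y ∈ e.target := by
      have hY' : Y ∈ (D.chart (1 : G)).target := D.mem_chart_target.2 hY
      rw [extChartAt_target, modelWithCornersSelf_coe, range_id, inter_univ]
      exact hY'
    have hinv := isInvertible_mfderivWithin_extChartAt_symm (I := 𝓘(ℝ, F)) hYt
    rw [modelWithCornersSelf_coe, range_id] at hinv
    have hs : MDifferentiableWithinAt 𝓘(ℝ, F) 𝓘(ℝ, F) e.symm univ Y := by
      have := mdifferentiableWithinAt_extChartAt_symm (I := 𝓘(ℝ, F)) hYt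
      rwa [modelWithCornersSelf_coe, range_id] at this
    have hs' : (mfderivWithin 𝓘(ℝ, F) 𝓘(ℝ, F) e.symm univ Y : F →L[ℝ] F) (W u Y) =
        mulInvariantVectorField (I := 𝓘(ℝ, F)) (G := G) u (e.symm Y) := by
      simp only [W, mpullbackWithin_apply]
      exact hinv.self_apply_inverse _
    have hc := mfderivWithin_comp (I := 𝓘(ℝ, F)) (I' := 𝓘(ℝ, F)) (I'' := 𝓘(ℝ, A)) Y
      ((D.contMDiff_incl (e.symm Y)).mdifferentiableAt
        (by simp)).mdifferentiableWithinAt hs (u := univ) (subset_univ _) (uniqueMDiffWithinAt_univ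
            _)
    have he : D.incl ∘ e.symm =ᶠ[𝓝 Y] φ := by
      filter_upwards [(D.isOpen_nhd.preimage D.tang.continuous).mem_nhds hY] with Z hZ
      have h := D.incl_chart_symm (g := 1) hZ
      rw [map_one, one_mul] at h
      exact h
    rw [mfderivWithin_univ, mfderivWithin_univ, he.mfderiv_eq, mfderiv_eq_fderiv] at hc
    have h3 := DFunLike.congr_fun hc (W u Y)
    refine h3.trans ((congrArg (mfderiv 𝓘(ℝ, F) 𝓘(ℝ, A) D.incl (e.symm Y) : F →L[ℝ] A) hs').trans
      ((D.mfderiv_incl_mulInvariantVectorField (e.symm Y) u).trans ?_))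
    rw [← he.eq_of_nhds]
    rfl
  have hφ0 : fderiv ℝ φ 0 = D.tang := by
    have h3 : HasFDerivAt (NormedSpace.exp : A → A) (1 : A →L[ℝ] A) (D.tang 0) := by
      rw [map_zero]; exact hasFDerivAt_exp_zero
    exact (h3.comp 0 D.tang.hasFDerivAt).fderiv
  -- At the origin `φ = 1` and `dφ = tang`, so this becomes the commutator of `tang u` and `tang v`.
  have key := fderiv_lieBracket_of_fderiv_apply_eq_mul (φ := φ)
    (D.contDiff_exp_coe.contDiffAt.of_le (by simp)) (hWd u) (hWd v) (hW u) (hW v)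
  have h1 := (hW u).self_of_nhds
  have h2 := (hW v).self_of_nhds
  rw [h1, h2, hφ0] at key
  have hφ1 : φ 0 = 1 := by simp [φ]
  rw [hφ1, one_mul, one_mul] at key
  have hb : (⁅u, v⁆ : GroupLieAlgebra 𝓘(ℝ, F) G) = lieBracket ℝ (W u) (W v) 0 := by
    rw [← h0]
    exact mlieBracket_eq_lieBracket _ _ _
  rw [hb]
  refine (D.inclDeriv_apply _).trans (key.trans ?_)
  exact (congrArg₂ (fun a b => a * b - b * a) (D.inclDeriv_apply u) (D.inclDeriv_apply v)).symm

end LinearGroupData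
end LieAlgebra

/-! ### Integrability from pairs of complementary subalgebras -/

section Algebra

variable {B : Type*} [Ring B] [Algebra ℂ B]

/-- Two subspaces closed under commutators which intersect in `0`. -/
structure IsLieSplitting (Q R : Submodule ℂ B) : Prop where
  left : ∀ x ∈ Q, ∀ y ∈ Q, x * y - y * x ∈ Q
  right : ∀ x ∈ R, ∀ y ∈ R, x * y - y * x ∈ R
  disjoint : ∀ x ∈ Q, x ∈ R → x = 0

/-- The Nijenhuis tensor of `P` vanishes if the eigenspaces of `P` for the eigenvalues `±c` are
contained in complementary Lie algebras. -/
lemma IsLieSplitting.nijenhuis_eq_zero {Q R : Submodule ℂ B} (h : IsLieSplitting Q R)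
    {𝔤 : Type*} [AddCommGroup 𝔤] [Module ℝ 𝔤] [Bracket 𝔤 𝔤] (κ : 𝔤 →+ B)
    (hsmul : ∀ (r : ℝ) x, κ (r • x) = (r : ℂ) • κ x)
    (hκ : Function.Injective κ) (hlie : ∀ x y : 𝔤, κ ⁅x, y⁆ = κ x * κ y - κ y * κ x)
    (P : 𝔤 →+ 𝔤) {c : ℂ} {ε : ℝ} (hc : c * c = ε)
    (hQ : ∀ x, c • κ x + κ (P x) ∈ Q) (hR : ∀ x, c • κ x - κ (P x) ∈ R) (x y : 𝔤) :
    ⁅P x, P y⁆ + ε • ⁅x, y⁆ - P ⁅P x, y⁆ - P ⁅x, P y⁆ = 0 := by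
  set a := κ ⁅P x, P y⁆ + (c * c) • κ ⁅x, y⁆ with ha
  set z : 𝔤 := ⁅P x, y⁆ + ⁅x, P y⁆ with hz
  have hκz : κ z = κ ⁅P x, y⁆ + κ ⁅x, P y⁆ := map_add κ _ _
  -- The commutator of `cx + Px` and `cy + Py` is `a + cz`; with minus signs it is `a - cz`.
  have h1 : a + c • κ z ∈ Q := by
    have := h.left _ (hQ x) _ (hQ y)
    convert this using 1
    rw [ha, hκz]
    simp only [hlie, mul_add, add_mul, smul_mul_assoc, mul_smul_comm]
    module
  have h2 : a - c • κ z ∈ R := by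
    have := h.right _ (hR x) _ (hR y)
    convert this using 1
    rw [ha, hκz]
    simp only [hlie, mul_sub, sub_mul, smul_mul_assoc, mul_smul_comm]
    module
  -- Removing `cz + Pz`, which is in `Q`, and adding `cz - Pz`, which is in `R`, brings both to the
  -- same element `a - Pz`, the image of the Nijenhuis tensor.
  have h3 : a - κ (P z) ∈ Q := by
    convert Q.sub_mem h1 (hQ z) using 1
    abel
  have h4 : a - κ (P z) ∈ R := by
    convert R.add_mem h2 (hR z) using 1
    abel
  apply hκ
  rw [map_zero, ← h.disjoint _ h3 h4, ha, hz, hc]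
  simp only [map_sub, map_add, hsmul]
  abel

lemma IsLieSplitting.symm {Q R : Submodule ℂ B} (h : IsLieSplitting Q R) : IsLieSplitting R Q :=
  ⟨h.right, h.left, fun x hx hx' => h.disjoint x hx' hx⟩

/-- A map that is multiplicative up to a scalar preserves commutators up to that scalar, which
subspaces do not notice. This admits a conjugation without its normalizing factor. -/
lemma IsLieSplitting.comap {Q R : Submodule ℂ B} (h : IsLieSplitting Q R) (T : B →ₗ[ℂ] B)
    (hT : Function.Injective T) {c : ℂ} (hc : ∀ x y, T (x * y) = c • (T x * T y)) :
    IsLieSplitting (Q.comap T) (R.comap T) where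
  left x hx y hy := by
    simp only [Submodule.mem_comap, map_sub, hc, ← smul_sub] at *
    exact Q.smul_mem _ (h.left _ hx _ hy)
  right x hx y hy := by
    simp only [Submodule.mem_comap, map_sub, hc, ← smul_sub] at *
    exact R.smul_mem _ (h.right _ hx _ hy)
  disjoint x hx hx' := hT (by rw [h.disjoint _ hx hx', map_zero])

end Algebra

/-! ### Endomorphisms in block form, and the criterion for a linear group -/

section BlockForm

variable {𝔤 ι : Type*} [AddCommGroup 𝔤] [Module ℝ 𝔤]

/-- The involution with `P U = T` and `P V = S` in each block of a basis. -/
def blockP (b : Module.Basis (Letter × ι) ℝ 𝔤) : 𝔤 →ₗ[ℝ] 𝔤 :=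
  b.constr ℝ fun p => match p with
    | (.U, β) => b (.T, β)
    | (.V, β) => b (.S, β)
    | (.S, β) => b (.V, β)
    | (.T, β) => b (.U, β)

/-- The complex structure with `J U = V` and `J S = T` in each block of a basis. -/
def blockJ (b : Module.Basis (Letter × ι) ℝ 𝔤) : 𝔤 →ₗ[ℝ] 𝔤 :=
  b.constr ℝ fun p => match p with
    | (.U, β) => b (.V, β)
    | (.V, β) => -b (.U, β)
    | (.S, β) => b (.T, β)
    | (.T, β) => -b (.S, β)

variable (b : Module.Basis (Letter × ι) ℝ 𝔤)

lemma blockP_U (β : ι) : blockP b (b (.U, β)) = b (.T, β) := by rw [blockP, b.constr_basis]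
lemma blockP_V (β : ι) : blockP b (b (.V, β)) = b (.S, β) := by rw [blockP, b.constr_basis]
lemma blockP_S (β : ι) : blockP b (b (.S, β)) = b (.V, β) := by rw [blockP, b.constr_basis]
lemma blockP_T (β : ι) : blockP b (b (.T, β)) = b (.U, β) := by rw [blockP, b.constr_basis]
lemma blockJ_U (β : ι) : blockJ b (b (.U, β)) = b (.V, β) := by rw [blockJ, b.constr_basis]
lemma blockJ_V (β : ι) : blockJ b (b (.V, β)) = -b (.U, β) := by rw [blockJ, b.constr_basis]
lemma blockJ_S (β : ι) : blockJ b (b (.S, β)) = b (.T, β) := by rw [blockJ, b.constr_basis]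
lemma blockJ_T (β : ι) : blockJ b (b (.T, β)) = -b (.S, β) := by rw [blockJ, b.constr_basis]

lemma blockP_blockP (v : 𝔤) : blockP b (blockP b v) = v := by
  have : blockP b ∘ₗ blockP b = LinearMap.id := b.ext fun ⟨x, β⟩ => by
    cases x <;> simp [blockP_U, blockP_V, blockP_S, blockP_T]
  exact LinearMap.congr_fun this v

lemma blockJ_blockJ (v : 𝔤) : blockJ b (blockJ b v) = -v := by
  have : blockJ b ∘ₗ blockJ b = -LinearMap.id := b.ext fun ⟨x, β⟩ => by
    cases x <;> simp [blockJ_U, blockJ_V, blockJ_S, blockJ_T]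
  exact LinearMap.congr_fun this v

lemma blockP_blockJ (v : 𝔤) : blockP b (blockJ b v) = -blockJ b (blockP b v) := by
  have : blockP b ∘ₗ blockJ b = -(blockJ b ∘ₗ blockP b) := b.ext fun ⟨x, β⟩ => by
    cases x <;> simp [blockJ_U, blockJ_V, blockJ_S, blockJ_T, blockP_U, blockP_V, blockP_S,
      blockP_T]
  exact LinearMap.congr_fun this v

variable {B : Type*} [Ring B] [Algebra ℂ B]

lemma forall_mem_of_basis {κ : Type*} (c : Module.Basis κ ℝ 𝔤) (f : 𝔤 →ₗ[ℝ] B)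
    (Q : Submodule ℂ B) (h : ∀ i, f (c i) ∈ Q) (v : 𝔤) : f v ∈ Q := by
  have : (⊤ : Submodule ℝ 𝔤) ≤ (Q.restrictScalars ℝ).comap f := by
    rw [← c.span_eq, Submodule.span_le]
    rintro _ ⟨i, rfl⟩
    exact h i
  exact this (Submodule.mem_top (x := v))

/-- The signs `s = 1` and `s = -1` give the two eigenspaces. Only `U` and `V` have to be checked:
since `s² = 1`, multiplication by `s` turns the conditions for `U`, `V` into those for `T`, `S`. -/
lemma smul_add_blockP_mem (κ : 𝔤 →ₗ[ℝ] B) (Q : Submodule ℂ B) (s : ℂ) (hs : s * s = 1)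
    (hU : ∀ β, κ (b (.U, β)) + s • κ (b (.T, β)) ∈ Q)
    (hV : ∀ β, κ (b (.V, β)) + s • κ (b (.S, β)) ∈ Q) (v : 𝔤) :
    κ v + s • κ (blockP b v) ∈ Q := by
  have key : ∀ x y : B, x + s • y ∈ Q → y + s • x ∈ Q := fun x y h => by
    have := Q.smul_mem s h
    rwa [smul_add, smul_smul, hs, one_smul, add_comm] at this
  refine forall_mem_of_basis b (κ + (LinearMap.lsmul ℂ B s).restrictScalars ℝ ∘ₗ κ ∘ₗ blockP b)
    Q ?_ v
  rintro ⟨x, β⟩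
  cases x
  · simpa [blockP_U] using hU β
  · simpa [blockP_V] using hV β
  · simpa [blockP_S] using key _ _ (hV β)
  · simpa [blockP_T] using key _ _ (hU β)

/-- As for `blockP`, now with `s = ±i`: multiplying by `s` turns `sU + V` into `sV - U`, the
combination required for `V`, and likewise for `S` and `T`. -/
lemma smul_add_blockJ_mem (κ : 𝔤 →ₗ[ℝ] B) (Q : Submodule ℂ B) (s : ℂ) (hs : s * s = -1)
    (hU : ∀ β, s • κ (b (.U, β)) + κ (b (.V, β)) ∈ Q)
    (hS : ∀ β, s • κ (b (.S, β)) + κ (b (.T, β)) ∈ Q) (v : 𝔤) :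
    s • κ v + κ (blockJ b v) ∈ Q := by
  have key : ∀ x y : B, s • x + y ∈ Q → s • y - x ∈ Q := fun x y h => by
    have := Q.smul_mem s h
    rwa [smul_add, smul_smul, hs, neg_one_smul, add_comm, ← sub_eq_add_neg] at this
  refine forall_mem_of_basis b ((LinearMap.lsmul ℂ B s).restrictScalars ℝ ∘ₗ κ + κ ∘ₗ blockJ b)
    Q ?_ v
  rintro ⟨x, β⟩
  cases x
  · simpa [blockJ_U] using hU β
  · simpa [blockJ_V, ← sub_eq_add_neg] using key _ _ (hU β)
  · simpa [blockJ_S] using hS β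
  · simpa [blockJ_T, ← sub_eq_add_neg] using key _ _ (hS β)

/-- Conditions on a basis of the Lie algebra of a linear group under which its block form defines a
left invariant complex product structure. -/
lemma exists_isComplexProductStructure_of_isLieSplitting
    {A G F : Type*} [NormedRing A] [NormedAlgebra ℝ A] [CompleteSpace A] [Group G]
    [TopologicalSpace G] [ContinuousMul G] [NormedAddCommGroup F] [NormedSpace ℝ F]
    [FiniteDimensional ℝ F] (D : LinearGroupData G A F) {e : Letter → ι → A}
    (b : Module.Basis (Letter × ι) ℝ F) (hb : ∀ x β, D.tang (b (x, β)) = e x β)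
    (Φ : A →ₐ[ℝ] B) (hΦ : Function.Injective Φ) {QP RP QJ RJ : Submodule ℂ B}
    (hP : IsLieSplitting QP RP) (hJ : IsLieSplitting QJ RJ)
    (hPU : ∀ β, Φ (e .U β) + Φ (e .T β) ∈ QP) (hPV : ∀ β, Φ (e .V β) + Φ (e .S β) ∈ QP)
    (hPU' : ∀ β, Φ (e .U β) - Φ (e .T β) ∈ RP) (hPV' : ∀ β, Φ (e .V β) - Φ (e .S β) ∈ RP)
    (hJU : ∀ β, Complex.I • Φ (e .U β) + Φ (e .V β) ∈ QJ)
    (hJS : ∀ β, Complex.I • Φ (e .S β) + Φ (e .T β) ∈ QJ)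
    (hJU' : ∀ β, Complex.I • Φ (e .U β) - Φ (e .V β) ∈ RJ)
    (hJS' : ∀ β, Complex.I • Φ (e .S β) - Φ (e .T β) ∈ RJ) :
    letI := D.chartedSpace
    haveI := D.lieGroup
    ∃ P J : TangentEnd 𝓘(ℝ, F) G,
      IsComplexProductStructure 𝓘(ℝ, F) P J ∧
      IsLeftInvariant 𝓘(ℝ, F) P ∧ IsLeftInvariant 𝓘(ℝ, F) J ∧ HasBlockForm D e P J := by
  let _ := D.chartedSpace
  have hL := D.lieGroup
  let P₀ : F →L[ℝ] F := LinearMap.toContinuousLinearMap (blockP b)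
  let J₀ : F →L[ℝ] F := LinearMap.toContinuousLinearMap (blockJ b)
  let κ : F →ₗ[ℝ] B := Φ.toLinearMap ∘ₗ D.tang.toLinearMap
  have hκe : ∀ x β, κ (b (x, β)) = Φ (e x β) := fun x β => congrArg Φ (hb x β)
  have hκ : Function.Injective κ := hΦ.comp (Function.LeftInverse.injective D.proj_tang)
  have hlie : ∀ x y : GroupLieAlgebra 𝓘(ℝ, F) G, κ (⁅x, y⁆ : GroupLieAlgebra 𝓘(ℝ, F) G) =
      κ x * κ y - κ y * κ x := by
    intro x y
    have h := D.inclDeriv_lie x y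
    have h' : ∀ v : GroupLieAlgebra 𝓘(ℝ, F) G, D.inclDeriv v = D.tang v :=
      fun v => D.inclDeriv_apply v
    rw [h', h', h'] at h
    exact (congrArg Φ h).trans (by simp; rfl)
  have hsmul : ∀ (r : ℝ) (x : F), κ (r • x) = (r : ℂ) • κ x := fun r x => by simp
  have hNP := fun x y => hP.nijenhuis_eq_zero (𝔤 := GroupLieAlgebra 𝓘(ℝ, F) G)
    κ.toAddMonoidHom hsmul hκ hlie (blockP b).toAddMonoidHom (c := 1) (ε := 1) (by simp)
    (fun v => by
      have := smul_add_blockP_mem b κ QP 1 (by simp) (by simpa [hκe] using hPU)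
        (by simpa [hκe] using hPV) v
      rwa [one_smul] at this ⊢)
    (fun v => by
      have := smul_add_blockP_mem b κ RP (-1) (by simp)
        (by simpa [hκe, ← sub_eq_add_neg] using hPU')
        (by simpa [hκe, ← sub_eq_add_neg] using hPV') v
      rw [one_smul]
      rwa [neg_one_smul, ← sub_eq_add_neg] at this) x y
  have hNJ := fun x y => hJ.nijenhuis_eq_zero (𝔤 := GroupLieAlgebra 𝓘(ℝ, F) G)
    κ.toAddMonoidHom hsmul hκ hlie (blockJ b).toAddMonoidHom (c := Complex.I) (ε := -1) (by simp)
    (smul_add_blockJ_mem b κ QJ Complex.I (by simp) (by simpa [hκe] using hJU)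
        (by simpa [hκe] using hJS))
    -- The second half uses `s = -i`, which yields the negative of the required element; membership
    -- in `RJ` is unaffected.
    (fun v => by
      have := smul_add_blockJ_mem b κ RJ (-Complex.I) (by simp)
        (fun β => by
          have := RJ.neg_mem (hJU' β)
          simp only [hκe]; convert this using 1; module)
        (fun β => by
          have := RJ.neg_mem (hJS' β)
          simp only [hκe]; convert this using 1; module) v
      convert RJ.neg_mem this using 1
      change Complex.I • κ v - κ (blockJ b v) = _
      module) x y
  refine ⟨leftInvariantEnd (I := 𝓘(ℝ, F)) P₀, leftInvariantEnd (I := 𝓘(ℝ, F)) J₀,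
    isComplexProductStructure_leftInvariantEnd (I := 𝓘(ℝ, F)) (P := P₀) (J := J₀)
      (blockP_blockP b) (blockJ_blockJ b) (blockP_blockJ b) hNP hNJ,
    isLeftInvariant_leftInvariantEnd _, isLeftInvariant_leftInvariantEnd _, b,
    fun x β => (D.inclDeriv_apply _).trans (hb x β), fun β => ⟨?_, ?_, ?_, ?_⟩⟩
  · exact (leftInvariantEnd_one (I := 𝓘(ℝ, F)) J₀ _).trans (blockJ_U b β)
  · exact (leftInvariantEnd_one (I := 𝓘(ℝ, F)) J₀ _).trans (blockJ_S b β)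
  · exact (leftInvariantEnd_one (I := 𝓘(ℝ, F)) P₀ _).trans (blockP_U b β)
  · exact (leftInvariantEnd_one (I := 𝓘(ℝ, F)) P₀ _).trans (blockP_V b β)

end BlockForm

/-! ### Triangular subalgebras and the Cayley transform -/

section Triangular

variable {n : ℕ}

/-- The matrices of trace `0` which are triangular with respect to `b` and whose diagonal entries
satisfy `α xₐₐ + β xₐ'ₐ' = 0` for `a` in the first half, where `a'` is the index opposite to `a`. -/
def triangularSubspace (b : Fin n → ℤ) (α β : ℂ) : Submodule ℂ (Matrix (Fin n) (Fin n) ℂ) where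
  carrier := {X | X.BlockTriangular b ∧
    (∀ a : Fin n, 2 * (a : ℕ) + 1 < n → α * X a a + β * X a.rev a.rev = 0) ∧ X.trace = 0}
  zero_mem' := ⟨blockTriangular_zero, by simp, by simp⟩
  add_mem' {X Y} hX hY := by
    refine ⟨hX.1.add hY.1, fun a ha => ?_, by rw [trace_add, hX.2.2, hY.2.2, add_zero]⟩
    have h1 := hX.2.1 a ha
    have h2 := hY.2.1 a ha
    simp only [Matrix.add_apply]
    linear_combination h1 + h2
  smul_mem' c X hX := by
    refine ⟨fun i j h => by simp [hX.1 h], fun a ha => ?_, by rw [trace_smul, hX.2.2, smul_zero]⟩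
    have h1 := hX.2.1 a ha
    simp only [Matrix.smul_apply, smul_eq_mul]
    linear_combination c * h1

/-- With `b` injective the matrices are triangular in the strict sense, so diagonals multiply
entrywise and a commutator has zero diagonal. Hence any linear condition on the diagonal is
preserved. -/
lemma mul_sub_mul_mem_triangularSubspace {b : Fin n → ℤ} (hb : Function.Injective b) {α β : ℂ}
    {X Y : Matrix (Fin n) (Fin n) ℂ} (hX : X ∈ triangularSubspace b α β)
    (hY : Y ∈ triangularSubspace b α β) : X * Y - Y * X ∈ triangularSubspace b α β := by
  have diag : ∀ {X Y : Matrix (Fin n) (Fin n) ℂ}, X.BlockTriangular b → Y.BlockTriangular b →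
      ∀ a, (X * Y) a a = X a a * Y a a := by
    intro X Y hX hY a
    rw [mul_apply]
    refine Finset.sum_eq_single a (fun c _ hc => ?_) (by simp)
    rcases lt_or_gt_of_ne (hb.ne hc) with h | h
    · rw [hX h, zero_mul]
    · rw [hY h, mul_zero]
  refine ⟨(hX.1.mul hY.1).sub (hY.1.mul hX.1), fun a _ => ?_, ?_⟩
  · simp only [Matrix.sub_apply, diag hX.1 hY.1, diag hY.1 hX.1]
    ring
  · rw [trace_sub, trace_mul_comm, sub_self]

/-- A common element is diagonal. Each opposite pair of diagonal entries satisfies two linear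
equations with nonzero determinant, and the unpaired middle entry, which exists as `n` is odd,
vanishes by the trace. -/
lemma isLieSplitting_triangularSubspace {b : Fin n → ℤ} (hb : Function.Injective b)
    (hn : Odd n) {α β α' β' : ℂ} (h : α * β' - α' * β ≠ 0) :
    IsLieSplitting (triangularSubspace b α β) (triangularSubspace (-b) α' β') where
  left x hx y hy := mul_sub_mul_mem_triangularSubspace hb hx hy
  right x hx y hy := mul_sub_mul_mem_triangularSubspace (neg_injective.comp hb) hx hy
  disjoint X hX hX' := by
    obtain ⟨k, rfl⟩ := hn
    have hoff : ∀ i j, i ≠ j → X i j = 0 := fun i j hij => by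
      rcases lt_or_gt_of_ne (hb.ne hij) with h | h
      · exact hX'.1 (by simpa using h)
      · exact hX.1 h
    have hlow : ∀ a : Fin (2 * k + 1), 2 * (a : ℕ) + 1 < 2 * k + 1 →
        X a a = 0 ∧ X a.rev a.rev = 0 := fun a ha => by
      have h1 := hX.2.1 a ha
      have h2 := hX'.2.1 a ha
      constructor
      · refine (mul_eq_zero.1 (?_ : (α * β' - α' * β) * X a a = 0)).resolve_left h
        linear_combination β' * h1 - β * h2
      · refine (mul_eq_zero.1 (?_ : (α * β' - α' * β) * X a.rev a.rev = 0)).resolve_left h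
        linear_combination α * h2 - α' * h1
    have hdiag : ∀ a : Fin (2 * k + 1), a ≠ ⟨k, by omega⟩ → X a a = 0 := fun a ha => by
      rcases lt_or_ge (a : ℕ) k with h | h
      · exact (hlow a (by omega)).1
      · have := (hlow a.rev (by
          have : (a : ℕ) ≠ k := fun h => ha (Fin.ext h)
          rw [Fin.val_rev]; omega)).2
        rwa [Fin.rev_rev] at this
    have hmid : X ⟨k, by omega⟩ ⟨k, by omega⟩ = 0 := by
      have h := hX.2.2
      simp only [trace, diag_apply] at h
      rwa [Finset.sum_eq_single (⟨k, by omega⟩ : Fin (2 * k + 1)) (fun a _ ha => hdiag a ha)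
        (fun h => (h (Finset.mem_univ _)).elim)] at h
    ext i j
    by_cases hij : i = j
    · subst hij
      by_cases hi : i = ⟨k, by omega⟩
      · rw [hi]; exact hmid
      · exact hdiag i hi
    · exact hoff i j hij

/-- The upper triangular matrices in `triangularSubspace`. -/
abbrev upperSubspace (n : ℕ) (α β : ℂ) : Submodule ℂ (Matrix (Fin n) (Fin n) ℂ) :=
  triangularSubspace (fun a => ((a : ℕ) : ℤ)) α β

/-- The lower triangular matrices in `triangularSubspace`. -/
abbrev lowerSubspace (n : ℕ) (α β : ℂ) : Submodule ℂ (Matrix (Fin n) (Fin n) ℂ) :=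
  triangularSubspace (-fun a : Fin n => ((a : ℕ) : ℤ)) α β

lemma isLieSplitting_upperSubspace_lowerSubspace (hn : Odd n) {α β α' β' : ℂ}
    (h : α * β' - α' * β ≠ 0) : IsLieSplitting (upperSubspace n α β) (lowerSubspace n α' β') :=
  isLieSplitting_triangularSubspace (fun _ _ hab => Fin.ext (Int.ofNat_inj.1 hab)) hn h

/-- The matrix of the permutation which reverses the order of the basis. -/
def reversal (n : ℕ) : Matrix (Fin n) (Fin n) ℂ := Matrix.of fun a b => if b = a.rev then 1 else 0

lemma reversal_mul_apply (X : Matrix (Fin n) (Fin n) ℂ) (a b : Fin n) :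
    (reversal n * X) a b = X a.rev b := by
  simp [reversal, mul_apply]

lemma mul_reversal_apply (X : Matrix (Fin n) (Fin n) ℂ) (a b : Fin n) :
    (X * reversal n) a b = X a b.rev := by
  have e : ∀ c : Fin n, b = c.rev ↔ c = b.rev := fun c => by rw [eq_comm, Fin.rev_eq_iff]
  simp [reversal, mul_apply, e]

lemma reversal_mul_reversal (n : ℕ) : reversal n * reversal n = 1 := by
  ext a b
  rw [reversal_mul_apply]
  simp [reversal, one_apply, eq_comm]

/-- A multiple of the conjugation with `1 + i w`, where `w` is the reversal matrix. -/
def cayley (n : ℕ) : Matrix (Fin n) (Fin n) ℂ →ₗ[ℂ] Matrix (Fin n) (Fin n) ℂ :=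
  LinearMap.mulLeft ℂ (1 - Complex.I • reversal n) ∘ₗ
    LinearMap.mulRight ℂ (1 + Complex.I • reversal n)

lemma cayley_apply (X : Matrix (Fin n) (Fin n) ℂ) :
    cayley n X = (1 - Complex.I • reversal n) * (X * (1 + Complex.I • reversal n)) := rfl

/-- As `w² = 1`, the product is `1 - i² = 2`. So `1 - iw` is twice the inverse of `1 + iw`, whence
the factor `1/2` in `cayley_mul`. -/
lemma one_add_mul_one_sub_reversal (n : ℕ) :
    (1 + Complex.I • reversal n) * (1 - Complex.I • reversal n) = (2 : ℂ) • 1 := by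
  simp only [mul_sub, add_mul, mul_one, one_mul, smul_mul_assoc, mul_smul_comm,
    reversal_mul_reversal]
  match_scalars
  · linear_combination -Complex.I_mul_I
  · ring

lemma cayley_mul (X Y : Matrix (Fin n) (Fin n) ℂ) :
    cayley n (X * Y) = (2⁻¹ : ℂ) • (cayley n X * cayley n Y) := by
  have : cayley n X * cayley n Y = (1 - Complex.I • reversal n) * (X *
      (((1 + Complex.I • reversal n) * (1 - Complex.I • reversal n)) *
        (Y * (1 + Complex.I • reversal n)))) := by
    simp only [cayley_apply, Matrix.mul_assoc]
  rw [this, one_add_mul_one_sub_reversal, smul_mul_assoc, mul_smul_comm, mul_smul_comm, smul_smul,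
    one_mul, cayley_apply, Matrix.mul_assoc, inv_mul_cancel₀ two_ne_zero, one_smul]

lemma cayley_injective (n : ℕ) : Function.Injective (cayley n) := by
  rw [injective_iff_map_eq_zero]
  intro X hX
  have : (1 + Complex.I • reversal n) * cayley n X * (1 - Complex.I • reversal n) =
      (4 : ℂ) • X := by
    rw [cayley_apply, ← Matrix.mul_assoc, one_add_mul_one_sub_reversal, Matrix.mul_assoc,
      Matrix.mul_assoc, one_add_mul_one_sub_reversal]
    simp only [smul_mul_assoc, mul_smul_comm, one_mul, mul_one, smul_smul]
    norm_num
  rw [hX, mul_zero, zero_mul] at this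
  exact (smul_eq_zero.1 this.symm).resolve_left (by norm_num)

end Triangular

/-! ### Matrix units -/

section MatrixUnits

variable {n : ℕ}

lemma mE_apply {R : Type*} [Zero R] [One R] (j k : ℕ) (a b : Fin n) :
    (mE j k : Matrix (Fin n) (Fin n) R) a b =
      if (a : ℕ) + 1 = j ∧ (b : ℕ) + 1 = k then 1 else 0 := rfl

lemma map_mE {R S : Type*} [Semiring R] [Semiring S] (f : R →+* S) (j k : ℕ) :
    (mE j k : Matrix (Fin n) (Fin n) R).map f = mE j k := by
  ext a b
  simp [mE_apply, apply_ite f]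

/-- Numbered from `1`, the reversal exchanges `j` with `n + 1 - j = 2m - j`; left multiplication
acts on the row index and right multiplication on the column index. -/
lemma cayley_mE {m j k : ℕ} (hn : n + 1 = 2 * m) (hj : 1 ≤ j) (hjn : j < 2 * m) (hk : 1 ≤ k)
    (hkn : k < 2 * m) :
    cayley n (mE j k) = mE j k - Complex.I • mE (2 * m - j) k + Complex.I • mE j (2 * m - k)
      + mE (2 * m - j) (2 * m - k) := by
  have h1 : ∀ l, (reversal n * mE j l : Matrix (Fin n) (Fin n) ℂ) = mE (2 * m - j) l := fun l => by
    ext a b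
    rw [reversal_mul_apply, mE_apply, mE_apply]
    exact if_congr (and_congr_left' (by rw [Fin.val_rev]; omega)) rfl rfl
  have h2 : ∀ l, (mE l k * reversal n : Matrix (Fin n) (Fin n) ℂ) = mE l (2 * m - k) := fun l => by
    ext a b
    rw [mul_reversal_apply, mE_apply, mE_apply]
    exact if_congr (and_congr_right' (by rw [Fin.val_rev]; omega)) rfl rfl
  simp only [cayley_apply, sub_mul, mul_add, mul_one, one_mul, smul_mul_assoc, mul_smul_comm, h2,
    h1]
  match_scalars <;> first | ring1 | linear_combination -Complex.I_mul_I

lemma trace_mE {R : Type*} [Semiring R] {j k : ℕ} :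
    (mE j k : Matrix (Fin n) (Fin n) R).trace = if j = k ∧ 1 ≤ j ∧ j ≤ n then 1 else 0 := by
  split_ifs with h
  · obtain ⟨rfl, h1, h2⟩ := h
    rw [trace, Finset.sum_eq_single ⟨j - 1, by omega⟩]
    · simp only [diag_apply, mE_apply]
      rw [if_pos ⟨by omega, by omega⟩]
    · intro a _ ha
      simp only [diag_apply, mE_apply]
      exact if_neg fun h => ha (Fin.ext (by simp; omega))
    · simp
  · refine Finset.sum_eq_zero fun a _ => ?_
    simp only [diag_apply, mE_apply]
    exact if_neg fun h' => h (by omega)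

lemma mE_mem_upper {j k : ℕ} (h : j < k) (α β : ℂ) :
    (mE j k : Matrix (Fin n) (Fin n) ℂ) ∈ upperSubspace n α β := by
  refine ⟨fun a b hab => ?_, fun a _ => ?_, ?_⟩
  · exact if_neg (by push_cast at hab; omega)
  · rw [mE_apply, mE_apply, if_neg (by omega), if_neg (by omega)]; simp
  · rw [trace_mE, if_neg (by omega)]

lemma mE_mem_lower {j k : ℕ} (h : j < k) (α β : ℂ) :
    (mE k j : Matrix (Fin n) (Fin n) ℂ) ∈ lowerSubspace n α β := by
  refine ⟨fun a b hab => ?_, fun a _ => ?_, ?_⟩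
  · exact if_neg (by simp at hab; omega)
  · rw [mE_apply, mE_apply, if_neg (by omega), if_neg (by omega)]; simp
  · rw [trace_mE, if_neg (by omega)]

/-- The coefficient at the centre makes the trace `0` and is not subject to the relation between
opposite diagonal entries. -/
lemma diagonal_mem_triangularSubspace (b : Fin n → ℤ) {m j : ℕ} (hm : n + 1 = 2 * m) (hj : 1 ≤ j)
    (hjm : j < m) {α β c d : ℂ} (h : α * c + β * d = 0) :
    c • mE j j + d • mE (2 * m - j) (2 * m - j) - (c + d) • mE m m ∈
      triangularSubspace b α β := by
  refine ⟨fun a a' hab => ?_, fun a ha => ?_, ?_⟩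
  · have : (a : ℕ) ≠ a' := fun h => by rw [Fin.ext h] at hab; exact lt_irrefl _ hab
    have h' : ∀ l, (mE l l : Matrix (Fin n) (Fin n) ℂ) a a' = 0 := fun l => if_neg (by omega)
    simp [h']
  · simp only [Matrix.sub_apply, Matrix.add_apply, Matrix.smul_apply, smul_eq_mul, mE_apply,
      Fin.val_rev]
    by_cases hj : (a : ℕ) + 1 = j
    · rw [if_pos (by omega), if_neg (by omega), if_neg (by omega), if_neg (by omega),
        if_pos (by omega), if_neg (by omega)]
      linear_combination h
    · rw [if_neg (by omega), if_neg (by omega), if_neg (by omega), if_neg (by omega),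
        if_neg (by omega), if_neg (by omega)]
      ring
  · simp only [trace_sub, trace_add, trace_smul, trace_mE, true_and]
    rw [if_pos (by omega), if_pos (by omega), if_pos (by omega)]
    simp

end MatrixUnits

/-! ### Cayley transforms of the blocks -/

section Cayley

open Complex

/-- The transform involves only the positions `(j, k)`, `(j, 2m-k)`, `(k, 2m-j)`, `(2m-k, 2m-j)`,
all above the diagonal because `j < k < 2m-j`. The next lemma has the same positions and the two
after it the transposed ones. Strictly triangular matrices satisfy every diagonal relation, so `α`
and `β` are free. -/
lemma cayley_antisymm_add_mem {n m j k : ℕ} (hn : n + 1 = 2 * m) (hj : 1 ≤ j) (hjk : j < k)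
    (hk : k < 2 * m - j) (α β : ℂ) :
    cayley n (I • (mE j k - mE k j) + (mE k (2 * m - j) - mE (2 * m - j) k)) ∈
      upperSubspace n α β := by
  have e : cayley n (I • (mE j k - mE k j) + (mE k (2 * m - j) - mE (2 * m - j) k)) =
      (2 * I) • mE j k - (2 : ℂ) • mE j (2 * m - k) + (2 : ℂ) • mE k (2 * m - j) -
        (2 * I) • mE (2 * m - k) (2 * m - j) := by
    have hs : 2 * m - (2 * m - j) = j := by omega
    simp only [map_add, map_sub, map_smul]
    rw [cayley_mE hn (j := j) (k := k), cayley_mE hn (j := k) (k := j),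
      cayley_mE hn (j := k) (k := 2 * m - j), cayley_mE hn (j := 2 * m - j) (k := k), hs]
    · match_scalars <;> (ring_nf; try simp only [I_sq]; try ring)
    all_goals omega
  rw [e]
  have h {p q : ℕ} (c : ℂ) (hpq : p < q) :=
    Submodule.smul_mem (upperSubspace n α β) c (mE_mem_upper (n := n) hpq α β)
  exact sub_mem (add_mem (sub_mem (h _ (by omega)) (h _ (by omega))) (h _ (by omega)))
      (h _ (by omega))

lemma cayley_symm_add_mem {n m j k : ℕ} (hn : n + 1 = 2 * m) (hj : 1 ≤ j) (hjk : j < k)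
    (hk : k < 2 * m - j) (α β : ℂ) :
    cayley n (I • (mE k (2 * m - j) + mE (2 * m - j) k) + (mE j k + mE k j)) ∈
      upperSubspace n α β := by
  have e : cayley n (I • (mE k (2 * m - j) + mE (2 * m - j) k) + (mE j k + mE k j)) =
      (2 : ℂ) • mE j k + (2 * I) • mE j (2 * m - k) + (2 * I) • mE k (2 * m - j) +
        (2 : ℂ) • mE (2 * m - k) (2 * m - j) := by
    have hs : 2 * m - (2 * m - j) = j := by omega
    simp only [map_add, map_smul]
    rw [cayley_mE hn (j := j) (k := k), cayley_mE hn (j := k) (k := j),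
      cayley_mE hn (j := k) (k := 2 * m - j), cayley_mE hn (j := 2 * m - j) (k := k), hs]
    · match_scalars <;> (ring_nf; try simp only [I_sq]; try ring)
    all_goals omega
  rw [e]
  have h {p q : ℕ} (c : ℂ) (hpq : p < q) :=
    Submodule.smul_mem (upperSubspace n α β) c (mE_mem_upper (n := n) hpq α β)
  exact add_mem (add_mem (add_mem (h _ (by omega)) (h _ (by omega))) (h _ (by omega)))
      (h _ (by omega))

lemma cayley_antisymm_sub_mem {n m j k : ℕ} (hn : n + 1 = 2 * m) (hj : 1 ≤ j) (hjk : j < k)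
    (hk : k < 2 * m - j) (α β : ℂ) :
    cayley n (I • (mE j k - mE k j) - (mE k (2 * m - j) - mE (2 * m - j) k)) ∈
      lowerSubspace n α β := by
  have e : cayley n (I • (mE j k - mE k j) - (mE k (2 * m - j) - mE (2 * m - j) k)) =
      (2 : ℂ) • mE (2 * m - j) k + (2 * I) • mE (2 * m - j) (2 * m - k) - (2 * I) • mE k j -
        (2 : ℂ) • mE (2 * m - k) j := by
    have hs : 2 * m - (2 * m - j) = j := by omega
    simp only [map_sub, map_smul]
    rw [cayley_mE hn (j := j) (k := k), cayley_mE hn (j := k) (k := j),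
      cayley_mE hn (j := k) (k := 2 * m - j), cayley_mE hn (j := 2 * m - j) (k := k), hs]
    · match_scalars <;> (ring_nf; try simp only [I_sq]; try ring)
    all_goals omega
  rw [e]
  have h {p q : ℕ} (c : ℂ) (hpq : p < q) :=
    Submodule.smul_mem (lowerSubspace n α β) c (mE_mem_lower (n := n) hpq α β)
  exact sub_mem (sub_mem (add_mem (h _ (by omega)) (h _ (by omega))) (h _ (by omega)))
      (h _ (by omega))

lemma cayley_symm_sub_mem {n m j k : ℕ} (hn : n + 1 = 2 * m) (hj : 1 ≤ j) (hjk : j < k)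
    (hk : k < 2 * m - j) (α β : ℂ) :
    cayley n (I • (mE k (2 * m - j) + mE (2 * m - j) k) - (mE j k + mE k j)) ∈
      lowerSubspace n α β := by
  have e : cayley n (I • (mE k (2 * m - j) + mE (2 * m - j) k) - (mE j k + mE k j)) =
      (2 * I) • mE (2 * m - j) k - (2 : ℂ) • mE (2 * m - j) (2 * m - k) - (2 : ℂ) • mE k j +
        (2 * I) • mE (2 * m - k) j := by
    have hs : 2 * m - (2 * m - j) = j := by omega
    simp only [map_add, map_sub, map_smul]
    rw [cayley_mE hn (j := j) (k := k), cayley_mE hn (j := k) (k := j),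
      cayley_mE hn (j := k) (k := 2 * m - j), cayley_mE hn (j := 2 * m - j) (k := k), hs]
    · match_scalars <;> (ring_nf; try simp only [I_sq]; try ring)
    all_goals omega
  rw [e]
  have h {p q : ℕ} (c : ℂ) (hpq : p < q) :=
    Submodule.smul_mem (lowerSubspace n α β) c (mE_mem_lower (n := n) hpq α β)
  exact add_mem (sub_mem (sub_mem (h _ (by omega)) (h _ (by omega))) (h _ (by omega)))
      (h _ (by omega))

/-- The Cayley transform of the matrices in a block of diagonal type. -/
lemma cayley_corner {n m j : ℕ} (hn : n + 1 = 2 * m) (hj : 1 ≤ j) (hjm : j < m) (p q r s : ℂ) :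
    cayley n (p • mE j j + q • mE (2 * m - j) (2 * m - j) - (p + q) • mE m m +
      r • mE j (2 * m - j) + s • mE (2 * m - j) j) =
    (p + q + I * (r - s)) • mE j j + (p + q - I * (r - s)) • mE (2 * m - j) (2 * m - j) -
      ((p + q + I * (r - s)) + (p + q - I * (r - s))) • mE m m +
      (r + s + I * (p - q)) • mE j (2 * m - j) + (r + s - I * (p - q)) • mE (2 * m - j) j := by
  have hs : 2 * m - (2 * m - j) = j := by omega
  have hm : 2 * m - m = m := by omega
  simp only [map_add, map_sub, map_smul]
  rw [cayley_mE hn (j := j) (k := j), cayley_mE hn (j := 2 * m - j) (k := 2 * m - j),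
    cayley_mE hn (j := j) (k := 2 * m - j), cayley_mE hn (j := 2 * m - j) (k := j),
    cayley_mE hn (j := m) (k := m), hs, hm]
  · match_scalars <;> ring
  all_goals omega

/-- `h'` kills the coefficient of the corner `(2m-j, j)` below the diagonal, and `h` is the relation
for the transformed diagonal. -/
lemma cayley_corner_mem_upper {n m j : ℕ} (hn : n + 1 = 2 * m) (hj : 1 ≤ j) (hjm : j < m)
    {α β p q r s : ℂ} (h : α * (p + q + I * (r - s)) + β * (p + q - I * (r - s)) = 0)
    (h' : r + s - I * (p - q) = 0) :
    cayley n (p • mE j j + q • mE (2 * m - j) (2 * m - j) - (p + q) • mE m m +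
      r • mE j (2 * m - j) + s • mE (2 * m - j) j) ∈ upperSubspace n α β := by
  rw [cayley_corner hn hj hjm, h', zero_smul, add_zero]
  exact add_mem (diagonal_mem_triangularSubspace _ hn hj hjm h)
    (Submodule.smul_mem _ _ (mE_mem_upper (by omega) _ _))

lemma cayley_corner_mem_lower {n m j : ℕ} (hn : n + 1 = 2 * m) (hj : 1 ≤ j) (hjm : j < m)
    {α β p q r s : ℂ} (h : α * (p + q + I * (r - s)) + β * (p + q - I * (r - s)) = 0)
    (h' : r + s + I * (p - q) = 0) :
    cayley n (p • mE j j + q • mE (2 * m - j) (2 * m - j) - (p + q) • mE m m +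
      r • mE j (2 * m - j) + s • mE (2 * m - j) j) ∈ lowerSubspace n α β := by
  rw [cayley_corner hn hj hjm, h', zero_smul, add_zero]
  exact add_mem (diagonal_mem_triangularSubspace _ hn hj hjm h)
    (Submodule.smul_mem _ _ (mE_mem_lower (by omega) _ _))

end Cayley

/-! ### The eigenspaces for the two families of groups -/

section Structures

open Complex

/-- The inclusion of the real matrices in the complex matrices. -/
def complexify (n : ℕ) : Matrix (Fin n) (Fin n) ℝ →ₐ[ℝ] Matrix (Fin n) (Fin n) ℂ :=
  (Algebra.ofId ℝ ℂ).mapMatrix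

lemma complexify_injective (n : ℕ) : Function.Injective (complexify n) :=
  Matrix.map_injective (algebraMap ℝ ℂ).injective

lemma complexify_mE {n : ℕ} (j k : ℕ) : complexify n (mE j k) = mE j k :=
  map_mE (algebraMap ℝ ℂ) j k

lemma slElement_U_inl (m : ℕ) {j : ℕ} (h) :
    slElement m .U (.inl ⟨j, h⟩) = mE j j + mE (2 * m - j) (2 * m - j) - (2 : ℝ) • mE m m := rfl

lemma slElement_V_inl (m : ℕ) {j : ℕ} (h) :
    slElement m .V (.inl ⟨j, h⟩) = mE j (2 * m - j) - mE (2 * m - j) j := rfl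

lemma slElement_S_inl (m : ℕ) {j : ℕ} (h) :
    slElement m .S (.inl ⟨j, h⟩) = mE j (2 * m - j) + mE (2 * m - j) j := rfl

lemma slElement_T_inl (m : ℕ) {j : ℕ} (h) :
    slElement m .T (.inl ⟨j, h⟩) = mE j j - mE (2 * m - j) (2 * m - j) := rfl

lemma slElement_U_inr (m : ℕ) {j k : ℕ} (h) :
    slElement m .U (.inr ⟨(j, k), h⟩) = mE j k - mE k j := rfl

lemma slElement_V_inr (m : ℕ) {j k : ℕ} (h) :
    slElement m .V (.inr ⟨(j, k), h⟩) = mE k (2 * m - j) - mE (2 * m - j) k := rfl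

lemma slElement_S_inr (m : ℕ) {j k : ℕ} (h) :
    slElement m .S (.inr ⟨(j, k), h⟩) = mE k (2 * m - j) + mE (2 * m - j) k := rfl

lemma slElement_T_inr (m : ℕ) {j k : ℕ} (h) :
    slElement m .T (.inr ⟨(j, k), h⟩) = mE j k + mE k j := rfl

lemma suElement_U_inl (m : ℕ) {j : ℕ} (h) :
    suElement m .U (.inl ⟨j, h⟩) =
        Complex.I • (mE j j + mE (2 * m - j) (2 * m - j) - (2 : ℂ) • mE m m) := rfl

lemma suElement_V_inl (m : ℕ) {j : ℕ} (h) :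
    suElement m .V (.inl ⟨j, h⟩) = Complex.I • (mE j j - mE (2 * m - j) (2 * m - j)) := rfl

lemma suElement_S_inl (m : ℕ) {j : ℕ} (h) :
    suElement m .S (.inl ⟨j, h⟩) = mE j (2 * m - j) + mE (2 * m - j) j := rfl

lemma suElement_T_inl (m : ℕ) {j : ℕ} (h) :
    suElement m .T (.inl ⟨j, h⟩) = Complex.I • (mE j (2 * m - j) - mE (2 * m - j) j) := rfl

lemma suElement_U_inr_of_le {m j k : ℕ} (h) (hkm : k ≤ m) :
    suElement m .U (.inr ⟨(j, k), h⟩) = mE j k - mE k j :=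
  if_pos hkm

lemma suElement_U_inr_of_not_le {m j k : ℕ} (h) (hkm : ¬k ≤ m) :
    suElement m .U (.inr ⟨(j, k), h⟩) =
      mE k (2 * m - j) - mE (2 * m - j) k :=
  if_neg hkm

lemma suElement_V_inr_of_le {m j k : ℕ} (h) (hkm : k ≤ m) :
    suElement m .V (.inr ⟨(j, k), h⟩) = Complex.I • (mE j k + mE k j) :=
  if_pos hkm

lemma suElement_V_inr_of_not_le {m j k : ℕ} (h) (hkm : ¬k ≤ m) :
    suElement m .V (.inr ⟨(j, k), h⟩) =
      Complex.I • (mE k (2 * m - j) + mE (2 * m - j) k) :=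
  if_neg hkm

lemma suElement_S_inr_of_le {m j k : ℕ} (h) (hkm : k ≤ m) :
    suElement m .S (.inr ⟨(j, k), h⟩) = mE k (2 * m - j) + mE (2 * m - j) k :=
  if_pos hkm

lemma suElement_S_inr_of_not_le {m j k : ℕ} (h) (hkm : ¬k ≤ m) :
    suElement m .S (.inr ⟨(j, k), h⟩) =
      -mE j k - mE k j :=
  if_neg hkm

lemma suElement_T_inr_of_le {m j k : ℕ} (h) (hkm : k ≤ m) :
    suElement m .T (.inr ⟨(j, k), h⟩) = Complex.I • (mE k (2 * m - j) - mE (2 * m - j) k) :=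
  if_pos hkm

lemma suElement_T_inr_of_not_le {m j k : ℕ} (h) (hkm : ¬k ≤ m) :
    suElement m .T (.inr ⟨(j, k), h⟩) =
      Complex.I • (mE k j - mE j k) :=
  if_neg hkm

lemma slR_exists_isComplexProductStructure {m : ℕ}
    (b : Module.Basis (Letter × BlockIndex m) ℝ (LieModel (slR (2 * m - 1))))
    (hb : ∀ x β, (slData (2 * m - 1)).tang (b (x, β)) = slElement m x β) (hm : 1 < m) :
    ∃ P J : TangentEnd 𝓘(ℝ, LieModel (slR (2 * m - 1))) (SLR (2 * m - 1)),
      IsComplexProductStructure 𝓘(ℝ, LieModel (slR (2 * m - 1))) P J ∧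
      IsLeftInvariant 𝓘(ℝ, LieModel (slR (2 * m - 1))) P ∧
      IsLeftInvariant 𝓘(ℝ, LieModel (slR (2 * m - 1))) J ∧
      HasBlockForm (slData (2 * m - 1)) (slElement m) P J := by
  have hn : 2 * m - 1 + 1 = 2 * m := by omega
  -- The relations are dictated by the diagonal blocks: `U + T` is zero at place `2m-j` and `U - T`
  -- at place `j`. The Cayley transforms of `iU + V` and `iU - V` obey the same relations.
  have hsplit : IsLieSplitting (upperSubspace (2 * m - 1) 0 1) (lowerSubspace (2 * m - 1) 1 0) :=
    isLieSplitting_upperSubspace_lowerSubspace ⟨m - 1, by omega⟩ (by simp)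
  refine exists_isComplexProductStructure_of_isLieSplitting (slData (2 * m - 1)) b hb
    (complexify _) (complexify_injective _) hsplit
    (hsplit.comap (cayley _) (cayley_injective _) cayley_mul) ?_ ?_ ?_ ?_ ?_ ?_ ?_ ?_
  all_goals
    rintro (⟨j, h⟩ | ⟨⟨j, k⟩, h⟩)
    on_goal 1 =>
      obtain ⟨hj, hjm⟩ : 1 ≤ j ∧ j < m := ⟨h.1, by have := h.2; omega⟩
      simp only [slElement_U_inl, slElement_V_inl, slElement_S_inl, slElement_T_inl]
    on_goal 2 =>
      obtain ⟨hj, hjk, hk⟩ : 1 ≤ j ∧ j < k ∧ k < 2 * m - j := ⟨h.1.1, h.2⟩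
      simp only [slElement_U_inr, slElement_V_inr, slElement_S_inr, slElement_T_inr]
    all_goals simp only [map_add, map_sub, map_smul, complexify_mE]
  · convert diagonal_mem_triangularSubspace _ hn hj hjm
      (show (0 : ℂ) * 2 + 1 * 0 = 0 by simp) using 1
    module
  · convert Submodule.smul_mem _ (2 : ℂ) (mE_mem_upper (show j < k by omega) _ _) using 1
    module
  · convert Submodule.smul_mem _ (2 : ℂ) (mE_mem_upper (show j < 2 * m - j by omega) _ _) using 1
    module
  · convert Submodule.smul_mem _ (2 : ℂ) (mE_mem_upper (show k < 2 * m - j by omega) _ _) using 1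
    module
  · convert diagonal_mem_triangularSubspace _ hn hj hjm
      (show (1 : ℂ) * 0 + 0 * 2 = 0 by simp) using 1
    module
  · convert Submodule.smul_mem _ (-2 : ℂ) (mE_mem_lower (show j < k by omega) _ _) using 1
    module
  · convert Submodule.smul_mem _ (-2 : ℂ) (mE_mem_lower (show j < 2 * m - j by omega) _ _) using 1
    module
  · convert Submodule.smul_mem _ (-2 : ℂ) (mE_mem_lower (show k < 2 * m - j by omega) _ _) using 1
    module
  · rw [Submodule.mem_comap]
    convert cayley_corner_mem_upper hn hj hjm (α := 0) (β := 1) (p := I) (q := I) (r := 1)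
      (s := -1) (by ring) (by ring) using 2
    module
  · exact cayley_antisymm_add_mem hn hj hjk hk _ _
  · rw [Submodule.mem_comap]
    convert cayley_corner_mem_upper hn hj hjm (α := 0) (β := 1) (p := 1) (q := -1) (r := I)
      (s := I) (by ring) (by ring) using 2
    module
  · exact cayley_symm_add_mem hn hj hjk hk _ _
  · rw [Submodule.mem_comap]
    convert cayley_corner_mem_lower hn hj hjm (α := 1) (β := 0) (p := I) (q := I) (r := -1)
      (s := 1) (by ring) (by ring) using 2
    module
  · exact cayley_antisymm_sub_mem hn hj hjk hk _ _
  · rw [Submodule.mem_comap]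
    convert cayley_corner_mem_lower hn hj hjm (α := 1) (β := 0) (p := -1) (q := 1) (r := I)
      (s := I) (by ring) (by ring) using 2
    module
  · exact cayley_symm_sub_mem hn hj hjk hk _ _

lemma su_exists_isComplexProductStructure {m : ℕ}
    (b : Module.Basis (Letter × BlockIndex m) ℝ (LieModel (su m (m - 1))))
    (hb : ∀ x β, (suData m (m - 1)).tang (b (x, β)) = suElement m x β) (hm : 1 < m) :
    ∃ P J : TangentEnd 𝓘(ℝ, LieModel (su m (m - 1))) (SU m (m - 1)),
      IsComplexProductStructure 𝓘(ℝ, LieModel (su m (m - 1))) P J ∧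
      IsLeftInvariant 𝓘(ℝ, LieModel (su m (m - 1))) P ∧
      IsLeftInvariant 𝓘(ℝ, LieModel (su m (m - 1))) J ∧
      HasBlockForm (suData m (m - 1)) (suElement m) P J := by
  have hn : m + (m - 1) + 1 = 2 * m := by omega
  -- In the diagonal blocks `iU + V` has entries `-1+i`, `-1-i` at places `j`, `2m-j`, with quotient
  -- `i` of the second by the first; for `iU - V` the quotient is `-i`. This gives the coefficients
  -- `-i` and `i`.
  have hsplit : IsLieSplitting (upperSubspace (m + (m - 1)) (-I) 1)
      (lowerSubspace (m + (m - 1)) I 1) :=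
    isLieSplitting_upperSubspace_lowerSubspace ⟨m - 1, by omega⟩ (by
      intro h
      have : (-2 : ℂ) * I = 0 := by linear_combination h
      simp at this)
  -- Here the triangular pair serves `J` and the conjugate one `P`. The latter is reversed, as `U +
  -- T` and `V + S` transform to lower triangular matrices.
  refine exists_isComplexProductStructure_of_isLieSplitting (suData m (m - 1)) b hb
    (AlgHom.id ℝ _) (fun _ _ h => h)
    (hsplit.comap (cayley _) (cayley_injective _) cayley_mul).symm hsplit ?_ ?_ ?_ ?_ ?_ ?_ ?_ ?_
  all_goals
    rintro (⟨j, h⟩ | ⟨⟨j, k⟩, h⟩)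
    on_goal 1 =>
      obtain ⟨hj, hjm⟩ : 1 ≤ j ∧ j < m := ⟨h.1, by have := h.2; omega⟩
      simp only [suElement_U_inl, suElement_V_inl, suElement_S_inl, suElement_T_inl,
        AlgHom.id_apply]
    on_goal 2 =>
      obtain ⟨hj, hjk, hk⟩ : 1 ≤ j ∧ j < k ∧ k < 2 * m - j := ⟨h.1.1, h.2⟩
      by_cases hkm : k ≤ m
    on_goal 2 => simp only [suElement_U_inr_of_le h hkm, suElement_V_inr_of_le h hkm,
      suElement_S_inr_of_le h hkm, suElement_T_inr_of_le h hkm, AlgHom.id_apply]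
    on_goal 3 => simp only [suElement_U_inr_of_not_le h hkm, suElement_V_inr_of_not_le h hkm,
      suElement_S_inr_of_not_le h hkm, suElement_T_inr_of_not_le h hkm, AlgHom.id_apply]
  · rw [Submodule.mem_comap]
    convert cayley_corner_mem_lower hn hj hjm (α := I) (β := 1) (p := I) (q := I) (r := I)
      (s := -I) (by linear_combination 2 * I * I_mul_I) (by ring) using 2
    module
  -- `U + T` is `-i` times the combination transformed in `cayley_antisymm_sub_mem` if `k ≤ m`, and
  -- `-1` times it if `k > m`. The other off-diagonal conditions for `P` reduce likewise to the four
  -- lemmas used for `J` on `sl`.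
  · rw [Submodule.mem_comap]
    convert Submodule.smul_mem _ (-I : ℂ) (cayley_antisymm_sub_mem hn hj hjk hk I 1) using 1
    rw [← map_smul]
    congr 1
    match_scalars <;> first | ring1 | linear_combination I_mul_I | linear_combination -I_mul_I
  · rw [Submodule.mem_comap]
    convert Submodule.smul_mem _ (-1 : ℂ) (cayley_antisymm_sub_mem hn hj hjk hk I 1) using 1
    rw [← map_smul]
    congr 1
    match_scalars <;> ring
  · rw [Submodule.mem_comap]
    convert cayley_corner_mem_lower hn hj hjm (α := I) (β := 1) (p := I) (q := -I) (r := 1)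
      (s := 1) (by ring) (by linear_combination 2 * I_mul_I) using 2
    module
  · rw [Submodule.mem_comap]
    convert Submodule.smul_mem _ (-I : ℂ) (cayley_symm_sub_mem hn hj hjk hk I 1) using 1
    rw [← map_smul]
    congr 1
    match_scalars <;> first | ring1 | linear_combination I_mul_I
  · rw [Submodule.mem_comap]
    convert Submodule.smul_mem _ (1 : ℂ) (cayley_symm_sub_mem hn hj hjk hk I 1) using 1
    rw [← map_smul]
    congr 1
    match_scalars <;> ring
  · rw [Submodule.mem_comap]
    convert cayley_corner_mem_upper hn hj hjm (α := -I) (β := 1) (p := I) (q := I) (r := -I)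
      (s := I) (by linear_combination 2 * I * I_mul_I) (by ring) using 2
    module
  · rw [Submodule.mem_comap]
    convert Submodule.smul_mem _ (-I : ℂ) (cayley_antisymm_add_mem hn hj hjk hk (-I) 1) using 1
    rw [← map_smul]
    congr 1
    match_scalars <;> first | ring1 | linear_combination I_mul_I | linear_combination -I_mul_I
  · rw [Submodule.mem_comap]
    convert Submodule.smul_mem _ (1 : ℂ) (cayley_antisymm_add_mem hn hj hjk hk (-I) 1) using 1
    rw [← map_smul]
    congr 1
    match_scalars <;> ring
  · rw [Submodule.mem_comap]
    convert cayley_corner_mem_upper hn hj hjm (α := -I) (β := 1) (p := I) (q := -I) (r := -1)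
      (s := -1) (by ring) (by linear_combination -2 * I_mul_I) using 2
    module
  · rw [Submodule.mem_comap]
    convert Submodule.smul_mem _ (I : ℂ) (cayley_symm_add_mem hn hj hjk hk (-I) 1) using 1
    rw [← map_smul]
    congr 1
    match_scalars <;> first | ring1 | linear_combination I_mul_I | linear_combination -I_mul_I
  · rw [Submodule.mem_comap]
    convert Submodule.smul_mem _ (1 : ℂ) (cayley_symm_add_mem hn hj hjk hk (-I) 1) using 1
    rw [← map_smul]
    congr 1
    match_scalars <;> ring
  · convert diagonal_mem_triangularSubspace _ hn hj hjm
      (show (-I) * (-1 + I) + 1 * (-1 - I) = 0 by linear_combination -I_mul_I) using 1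
    match_scalars <;> first | ring1 | linear_combination I_mul_I | linear_combination -2 * I_mul_I
  · convert Submodule.smul_mem _ (2 * I : ℂ) (mE_mem_upper (show j < k by omega) _ _) using 1
    module
  · convert Submodule.smul_mem _ (2 * I : ℂ)
      (mE_mem_upper (show k < 2 * m - j by omega) _ _) using 1
    module
  · convert Submodule.smul_mem _ (2 * I : ℂ)
      (mE_mem_upper (show j < 2 * m - j by omega) _ _) using 1
    module
  · convert Submodule.smul_mem _ (2 * I : ℂ)
      (mE_mem_upper (show k < 2 * m - j by omega) _ _) using 1
    module
  · convert Submodule.smul_mem _ (-2 * I : ℂ) (mE_mem_upper (show j < k by omega) _ _) using 1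
    module
  · convert diagonal_mem_triangularSubspace _ hn hj hjm
      (show (I) * (-1 - I) + 1 * (-1 + I) = 0 by linear_combination -I_mul_I) using 1
    match_scalars <;> first | ring1 | linear_combination I_mul_I | linear_combination -2 * I_mul_I
  · convert Submodule.smul_mem _ (-2 * I : ℂ) (mE_mem_lower (show j < k by omega) _ _) using 1
    module
  · convert Submodule.smul_mem _ (-2 * I : ℂ)
      (mE_mem_lower (show k < 2 * m - j by omega) _ _) using 1
    module
  · convert Submodule.smul_mem _ (2 * I : ℂ)
      (mE_mem_lower (show j < 2 * m - j by omega) _ _) using 1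
    module
  · convert Submodule.smul_mem _ (2 * I : ℂ)
      (mE_mem_lower (show k < 2 * m - j by omega) _ _) using 1
    module
  · convert Submodule.smul_mem _ (-2 * I : ℂ) (mE_mem_lower (show j < k by omega) _ _) using 1
    module

end Structures

/-! ### Dual coordinates and the positions of the blocks -/

section Bases

open Classical in
-- Coordinates dual to `e` make `φ` surjective, and `hφ` makes it injective, so neither independence
-- nor a dimension count is needed.
lemma exists_basis_of_dual {V κ : Type*} [AddCommGroup V] [Module ℝ V] [Finite κ] (e : κ → V)
    (φ : V →ₗ[ℝ] κ → ℝ) (hφ : ∀ X, φ X = 0 → X = 0)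
    (he : ∀ a b, φ (e a) b = if a = b then 1 else 0) :
    ∃ b : Module.Basis κ ℝ V, ∀ a, b a = e a := by
  have hs : ∀ a, φ (e a) = Pi.single a 1 := fun a => by
    funext b
    rw [he, Pi.single_apply]
    simp only [eq_comm]
  have _ := Fintype.ofFinite κ
  have hb : Function.Bijective φ := by
    refine ⟨(injective_iff_map_eq_zero φ).2 hφ, fun f => ⟨∑ a, f a • e a, ?_⟩⟩
    simp_rw [map_sum, map_smul, hs, ← Pi.single_smul, smul_eq_mul, mul_one]
    exact Finset.univ_sum_single f
  refine ⟨Module.Basis.ofEquivFun (LinearEquiv.ofBijective φ hb), fun a => ?_⟩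
  rw [Module.Basis.coe_ofEquivFun, LinearEquiv.symm_apply_eq]
  exact (hs a).symm

open Classical in
lemma exists_basis_lieModel {V κ : Type*} [NormedRing V] [NormedAlgebra ℝ V]
    [FiniteDimensional ℝ V] [Finite κ] {𝔤 : Submodule ℝ V} (e : κ → V) (hmem : ∀ a, e a ∈ 𝔤)
    (φ : V →ₗ[ℝ] κ → ℝ) (hφ : ∀ X ∈ 𝔤, φ X = 0 → X = 0)
    (he : ∀ a b, φ (e a) b = if a = b then 1 else 0) :
    ∃ b : Module.Basis κ ℝ (LieModel 𝔤), ∀ a, tangOf 𝔤 (b a) = e a := by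
  obtain ⟨b, hb⟩ := exists_basis_of_dual (fun a => (⟨e a, hmem a⟩ : 𝔤)) (φ.comp 𝔤.subtype)
    (fun X hX => Subtype.ext (hφ X X.2 hX)) he
  refine ⟨b.map (modelEquiv 𝔤).symm.toLinearEquiv, fun a => ?_⟩
  simp [tangOf, hb]

instance : Finite Letter :=
  Finite.of_surjective ![Letter.U, Letter.V, Letter.S, Letter.T] fun
    | .U => ⟨0, rfl⟩
    | .V => ⟨1, rfl⟩
    | .S => ⟨2, rfl⟩
    | .T => ⟨3, rfl⟩

instance (m : ℕ) : Finite (BlockIndex m) := by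
  have h1 : Finite {j : ℕ // 1 ≤ j ∧ j ≤ m - 1} := (Set.finite_Icc 1 (m - 1)).to_subtype
  have h2 : Finite {p : ℕ × ℕ // (1 ≤ p.1 ∧ p.1 ≤ m - 1) ∧ p.1 < p.2 ∧ p.2 < 2 * m - p.1} :=
    (((Set.finite_Iio m).prod (Set.finite_Iio (2 * m))).subset fun p hp => by
      have hp' : (1 ≤ p.1 ∧ p.1 ≤ m - 1) ∧ p.1 < p.2 ∧ p.2 < 2 * m - p.1 := hp
      rw [Set.mem_prod, Set.mem_Iio, Set.mem_Iio]
      omega).to_subtype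
  infer_instance

/-- The four positions of a matrix that belong to a block of the bases, with rows and columns
numbered from `1`. -/
def blockPos {m : ℕ} : Fin 4 → BlockIndex m → ℕ × ℕ
  | 0, .inl j => (j, j)
  | 1, .inl j => (2 * m - j, 2 * m - j)
  | 2, .inl j => (j, 2 * m - j)
  | 3, .inl j => (2 * m - j, j)
  | 0, .inr p => (p.1.1, p.1.2)
  | 1, .inr p => (p.1.2, p.1.1)
  | 2, .inr p => (p.1.2, 2 * m - p.1.1)
  | 3, .inr p => (2 * m - p.1.1, p.1.2)

lemma blockPos_mem {m n : ℕ} (hn : n + 1 = 2 * m) (c : Fin 4) (β : BlockIndex m) :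
    (1 ≤ (blockPos c β).1 ∧ (blockPos c β).1 ≤ n) ∧
      1 ≤ (blockPos c β).2 ∧ (blockPos c β).2 ≤ n := by
  obtain ⟨j, h⟩ | ⟨⟨j, k⟩, h⟩ := β <;> fin_cases c <;> simp only [blockPos] at h ⊢ <;> omega

lemma blockPos_ne {m : ℕ} (c : Fin 4) (β : BlockIndex m) : blockPos c β ≠ (m, m) := by
  rw [Ne, Prod.ext_iff]
  obtain ⟨j, h⟩ | ⟨⟨j, k⟩, h⟩ := β <;> fin_cases c <;> simp only [blockPos] at h ⊢ <;> omega

/-- Distinct blocks occupy disjoint sets of positions, so the duality of the coordinates has to be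
computed only inside one block. -/
lemma blockPos_inj {m : ℕ} {c c' : Fin 4} {β β' : BlockIndex m} :
    blockPos c β = blockPos c' β' ↔ c = c' ∧ β = β' := by
  refine ⟨fun h => ?_, by rintro ⟨rfl, rfl⟩; rfl⟩
  rw [Prod.ext_iff] at h
  obtain ⟨j, hj⟩ | ⟨⟨j, k⟩, hj⟩ := β <;> obtain ⟨j', hj'⟩ | ⟨⟨j', k'⟩, hj'⟩ := β' <;>
    fin_cases c <;> fin_cases c' <;> simp [blockPos] at h hj hj' ⊢ <;> omega

lemma exists_blockPos_eq {m p q : ℕ} (hp : 1 ≤ p) (hp' : p < 2 * m) (hq : 1 ≤ q)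
    (hq' : q < 2 * m) (h : ¬(p = m ∧ q = m)) : ∃ c, ∃ β : BlockIndex m, blockPos c β = (p, q) := by
  by_cases h1 : p = q
  · subst h1
    by_cases h2 : p < m
    · exact ⟨0, .inl ⟨p, by omega⟩, rfl⟩
    · exact ⟨1, .inl ⟨2 * m - p, by omega⟩, by simp only [blockPos, Prod.ext_iff]; omega⟩
  by_cases h2 : p + q = 2 * m
  · by_cases h3 : p < m
    · exact ⟨2, .inl ⟨p, by omega⟩, by simp only [blockPos, Prod.ext_iff, true_and]; omega⟩
    · exact ⟨3, .inl ⟨q, by omega⟩, by simp only [blockPos, Prod.ext_iff, and_true]; omega⟩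
  -- Off both diagonals, the four triangles which they cut out correspond to the four positions of a
  -- block of type `(j, k)`.
  by_cases h3 : p < q <;> by_cases h4 : p + q < 2 * m
  · exact ⟨0, .inr ⟨(p, q), by dsimp only; omega⟩, rfl⟩
  · exact ⟨2, .inr ⟨(2 * m - q, p), by dsimp only; omega⟩,
      by simp only [blockPos, Prod.ext_iff, true_and]; omega⟩
  · exact ⟨1, .inr ⟨(q, p), by dsimp only; omega⟩, rfl⟩
  · exact ⟨3, .inr ⟨(2 * m - p, q), by dsimp only; omega⟩,
      by simp only [blockPos, Prod.ext_iff, and_true]; omega⟩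

/-- The matrix unit at a position of a block. -/
def blockUnit {m : ℕ} (n : ℕ) (R : Type*) [Zero R] [One R] (c : Fin 4) (β : BlockIndex m) :
    Matrix (Fin n) (Fin n) R :=
  mE (blockPos c β).1 (blockPos c β).2

section Entry

variable {n : ℕ} {R : Type*} [Semiring R] [Module ℝ R]

/-- The entry of a matrix at a given position, with rows and columns numbered from `1`. -/
def entry (p : ℕ × ℕ) : Matrix (Fin n) (Fin n) R →ₗ[ℝ] R :=
  -- Truncated subtraction reads the number `0` as `1`; block positions start at `1`, so this value
  -- and the default `0` outside the matrix play no role for them.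
  if h : p.1 - 1 < n ∧ p.2 - 1 < n then
    Matrix.entryLinearMap ℝ R ⟨p.1 - 1, h.1⟩ ⟨p.2 - 1, h.2⟩ else 0

lemma entry_succ (a b : Fin n) (X : Matrix (Fin n) (Fin n) R) :
    entry ((a : ℕ) + 1, (b : ℕ) + 1) X = X a b := by
  simp [entry]

lemma exists_entry_eq {p q : ℕ} (hp : 1 ≤ p ∧ p ≤ n) (hq : 1 ≤ q ∧ q ≤ n) :
    ∃ a b : Fin n, (a : ℕ) + 1 = p ∧ (b : ℕ) + 1 = q ∧
      (∀ X : Matrix (Fin n) (Fin n) R, entry (p, q) X = X a b) ∧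
      ∀ X : Matrix (Fin n) (Fin n) R, entry (q, p) X = X b a := by
  obtain ⟨p, rfl⟩ := Nat.exists_eq_add_of_le' hp.1
  obtain ⟨q, rfl⟩ := Nat.exists_eq_add_of_le' hq.1
  exact ⟨⟨p, hp.2⟩, ⟨q, hq.2⟩, rfl, rfl, entry_succ ⟨p, hp.2⟩ ⟨q, hq.2⟩,
    entry_succ ⟨q, hq.2⟩ ⟨p, hp.2⟩⟩

lemma entry_smul (p : ℕ × ℕ) (r : R) (X : Matrix (Fin n) (Fin n) R) :
    entry p (r • X) = r * entry p X := by
  unfold entry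
  split_ifs <;> simp

open Classical in
lemma entry_blockUnit {m : ℕ} (hn : n + 1 = 2 * m) (c c' : Fin 4) (β β' : BlockIndex m) :
    entry (blockPos c' β') (blockUnit n R c β) = if c = c' ∧ β = β' then 1 else 0 := by
  obtain ⟨h1, h2⟩ := blockPos_mem hn c' β'
  obtain ⟨a, b, ha, hb, h, -⟩ := exists_entry_eq (R := R) h1 h2
  rw [h, blockUnit, mE_apply, ha, hb]
  exact if_congr (by rw [← Prod.ext_iff, eq_comm, blockPos_inj]) rfl rfl

lemma entry_center {m : ℕ} (hn : n + 1 = 2 * m) (c : Fin 4) (β : BlockIndex m) :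
    entry (blockPos c β) (mE m m : Matrix (Fin n) (Fin n) R) = 0 := by
  obtain ⟨h1, h2⟩ := blockPos_mem hn c β
  obtain ⟨a, b, ha, hb, h, -⟩ := exists_entry_eq (R := R) h1 h2
  rw [h, mE_apply, ha, hb, if_neg fun h => blockPos_ne c β (Prod.ext h.1 h.2)]

/-- The blocks cover everything except the centre, and a matrix supported at the centre is
determined by its trace. -/
lemma eq_zero_of_entry_blockPos {m : ℕ} (hn : n + 1 = 2 * m) {X : Matrix (Fin n) (Fin n) R}
    (htr : X.trace = 0) (h : ∀ c, ∀ β : BlockIndex m, entry (blockPos c β) X = 0) : X = 0 := by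
  have h0 : ∀ a b : Fin n, ¬((a : ℕ) + 1 = m ∧ (b : ℕ) + 1 = m) → X a b = 0 := by
    intro a b hab
    obtain ⟨c, β, hc⟩ := exists_blockPos_eq (by omega) (by omega) (by omega) (by omega) hab
    rw [← entry_succ a b X, ← hc, h]
  ext a b
  by_cases hab : (a : ℕ) + 1 = m ∧ (b : ℕ) + 1 = m
  · obtain rfl : a = b := Fin.ext (by omega)
    rw [Matrix.trace, Finset.sum_eq_single a] at htr
    · exact htr
    · intro b _ hb
      exact h0 b b fun h' => hb (Fin.ext (by omega))
    · simp
  · exact h0 a b hab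

end Entry

end Bases

/-! ### The basis of `sl(2m-1, ℝ)` -/

section SlBasis

/-- The coordinates on `sl(2m-1, ℝ)` with respect to the basis `slElement`. -/
def slCoord (m : ℕ) : Matrix (Fin (2 * m - 1)) (Fin (2 * m - 1)) ℝ →ₗ[ℝ]
    Letter × BlockIndex m → ℝ :=
  LinearMap.pi fun
    | (.U, .inl j) => (2⁻¹ : ℝ) • (entry (blockPos 0 (.inl j)) + entry (blockPos 1 (.inl j)))
    | (.V, .inl j) => (2⁻¹ : ℝ) • (entry (blockPos 2 (.inl j)) - entry (blockPos 3 (.inl j)))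
    | (.S, .inl j) => (2⁻¹ : ℝ) • (entry (blockPos 2 (.inl j)) + entry (blockPos 3 (.inl j)))
    | (.T, .inl j) => (2⁻¹ : ℝ) • (entry (blockPos 0 (.inl j)) - entry (blockPos 1 (.inl j)))
    | (.U, .inr p) => (2⁻¹ : ℝ) • (entry (blockPos 0 (.inr p)) - entry (blockPos 1 (.inr p)))
    | (.V, .inr p) => (2⁻¹ : ℝ) • (entry (blockPos 2 (.inr p)) - entry (blockPos 3 (.inr p)))
    | (.S, .inr p) => (2⁻¹ : ℝ) • (entry (blockPos 2 (.inr p)) + entry (blockPos 3 (.inr p)))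
    | (.T, .inr p) => (2⁻¹ : ℝ) • (entry (blockPos 0 (.inr p)) + entry (blockPos 1 (.inr p)))

open Classical in
lemma slCoord_slElement {m : ℕ} (hm : 0 < m) (a b : Letter × BlockIndex m) :
    slCoord m (slElement m a.1 a.2) b = if a = b then 1 else 0 := by
  have hn : 2 * m - 1 + 1 = 2 * m := by omega
  have h := entry_blockUnit (R := ℝ) hn
  have h0 := entry_center (R := ℝ) hn
  have e1 : ∀ j : {j : ℕ // 1 ≤ j ∧ j ≤ m - 1},
      slElement m .U (.inl j) = blockUnit _ _ 0 (.inl j) + blockUnit _ _ 1 (.inl j)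
        - (2 : ℝ) • mE m m ∧
      slElement m .V (.inl j) = blockUnit _ _ 2 (.inl j) - blockUnit _ _ 3 (.inl j) ∧
      slElement m .S (.inl j) = blockUnit _ _ 2 (.inl j) + blockUnit _ _ 3 (.inl j) ∧
      slElement m .T (.inl j) = blockUnit _ _ 0 (.inl j) - blockUnit _ _ 1 (.inl j) := fun _ =>
    ⟨rfl, rfl, rfl, rfl⟩
  have e2 : ∀ p : {p : ℕ × ℕ // (1 ≤ p.1 ∧ p.1 ≤ m - 1) ∧ p.1 < p.2 ∧ p.2 < 2 * m - p.1},
      slElement m .U (.inr p) = blockUnit _ _ 0 (.inr p) - blockUnit _ _ 1 (.inr p) ∧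
      slElement m .V (.inr p) = blockUnit _ _ 2 (.inr p) - blockUnit _ _ 3 (.inr p) ∧
      slElement m .S (.inr p) = blockUnit _ _ 2 (.inr p) + blockUnit _ _ 3 (.inr p) ∧
      slElement m .T (.inr p) = blockUnit _ _ 0 (.inr p) + blockUnit _ _ 1 (.inr p) := fun _ =>
    ⟨rfl, rfl, rfl, rfl⟩
  obtain ⟨x, β⟩ := a
  obtain ⟨y, γ⟩ := b
  by_cases hβ : β = γ
  · subst hβ
    obtain j | p := β <;> cases x <;> cases y <;> simp [slCoord, e1, e2, h, h0] <;> norm_num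
  · have hab : ¬((x, β) = (y, γ)) := fun h' => hβ (congrArg Prod.snd h')
    have h' : ∀ c c', entry (blockPos c' γ) (blockUnit (2 * m - 1) ℝ c β) = 0 := fun c c' => by
      rw [h, if_neg fun h => hβ h.2]
    rw [if_neg hab]
    obtain j | p := β <;> obtain j' | p' := γ <;> cases x <;> cases y <;>
      simp [slCoord, e1, e2, h', h0]

lemma eq_zero_of_slCoord_eq_zero {m : ℕ} (hm : 0 < m) {X} (hX : X ∈ slR (2 * m - 1))
    (h : slCoord m X = 0) : X = 0 := by
  refine eq_zero_of_entry_blockPos (m := m) (by omega) (LinearMap.mem_ker.1 hX) fun c β => ?_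
  have hU := congrFun h (.U, β)
  have hV := congrFun h (.V, β)
  have hS := congrFun h (.S, β)
  have hT := congrFun h (.T, β)
  obtain j | p := β <;> fin_cases c <;> simp [slCoord] at hU hV hS hT ⊢ <;> linarith

lemma slElement_mem {m : ℕ} (x : Letter) (β : BlockIndex m) :
    slElement m x β ∈ slR (2 * m - 1) := by
  rw [LinearMap.mem_ker, Matrix.traceLinearMap_apply]
  obtain ⟨j, h⟩ | ⟨⟨j, k⟩, h⟩ := β <;> cases x <;> (try dsimp only at h) <;>
    simp only [slElement, trace_add, trace_sub, trace_smul, trace_mE, true_and] <;>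
    split_ifs <;> first | (exfalso; omega) | norm_num

lemma exists_basis_slElement {m : ℕ} (hm : 0 < m) :
    ∃ b : Module.Basis (Letter × BlockIndex m) ℝ (LieModel (slR (2 * m - 1))),
      ∀ x β, (slData (2 * m - 1)).tang (b (x, β)) = slElement m x β := by
  obtain ⟨b, hb⟩ := exists_basis_lieModel (fun a => slElement m a.1 a.2)
    (fun a => slElement_mem a.1 a.2) (slCoord m) (fun X => eq_zero_of_slCoord_eq_zero hm)
    (fun a b => by convert slCoord_slElement hm a b)
  exact ⟨b, fun x β => hb (x, β)⟩

end SlBasis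

/-! ### The basis of `su(m, m-1)` -/

section SuBasis

/-- The coordinates on `su(m, m-1)` with respect to the basis `suElement`. -/
def suCoord (m : ℕ) : Matrix (Fin (m + (m - 1))) (Fin (m + (m - 1))) ℂ →ₗ[ℝ]
    Letter × BlockIndex m → ℝ :=
  LinearMap.pi fun
    -- Half of the real data suffices on `su`: imaginary parts on the diagonal, and one entry from
    -- each pair of transposed positions.
    | (.U, .inl j) => (2⁻¹ : ℝ) • (Complex.imLm ∘ₗ (entry (blockPos 0 (.inl j))
        + entry (blockPos 1 (.inl j))))
    | (.V, .inl j) => (2⁻¹ : ℝ) • (Complex.imLm ∘ₗ (entry (blockPos 0 (.inl j))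
        - entry (blockPos 1 (.inl j))))
    | (.S, .inl j) => Complex.reLm ∘ₗ entry (blockPos 2 (.inl j))
    | (.T, .inl j) => Complex.imLm ∘ₗ entry (blockPos 2 (.inl j))
    | (.U, .inr p) => Complex.reLm ∘ₗ entry (blockPos (if p.1.2 ≤ m then 0 else 2) (.inr p))
    | (.V, .inr p) => Complex.imLm ∘ₗ entry (blockPos (if p.1.2 ≤ m then 0 else 2) (.inr p))
    | (.S, .inr p) => if p.1.2 ≤ m then Complex.reLm ∘ₗ entry (blockPos 2 (.inr p))
        else -(Complex.reLm ∘ₗ entry (blockPos 0 (.inr p)))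
    | (.T, .inr p) => if p.1.2 ≤ m then Complex.imLm ∘ₗ entry (blockPos 2 (.inr p))
        else -(Complex.imLm ∘ₗ entry (blockPos 0 (.inr p)))

open Classical in
lemma suCoord_suElement {m : ℕ} (hm : 0 < m) (a b : Letter × BlockIndex m) :
    suCoord m (suElement m a.1 a.2) b = if a = b then 1 else 0 := by
  have hn : m + (m - 1) + 1 = 2 * m := by omega
  have h := entry_blockUnit (R := ℂ) hn
  have h0 := entry_center (R := ℂ) hn
  have e1 : ∀ j : {j : ℕ // 1 ≤ j ∧ j ≤ m - 1},
      suElement m .U (.inl j) = Complex.I • (blockUnit _ _ 0 (.inl j) + blockUnit _ _ 1 (.inl j)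
        - (2 : ℂ) • mE m m) ∧
      suElement m .V (.inl j) =
        Complex.I • (blockUnit _ _ 0 (.inl j) - blockUnit _ _ 1 (.inl j)) ∧
      suElement m .S (.inl j) = blockUnit _ _ 2 (.inl j) + blockUnit _ _ 3 (.inl j) ∧
      suElement m .T (.inl j) =
        Complex.I • (blockUnit _ _ 2 (.inl j) - blockUnit _ _ 3 (.inl j)) := fun _ =>
    ⟨rfl, rfl, rfl, rfl⟩
  have e2 : ∀ p : {p : ℕ × ℕ // (1 ≤ p.1 ∧ p.1 ≤ m - 1) ∧ p.1 < p.2 ∧ p.2 < 2 * m - p.1},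
      suElement m .U (.inr p) = (if p.1.2 ≤ m then
        blockUnit _ _ 0 (.inr p) - blockUnit _ _ 1 (.inr p) else
        blockUnit _ _ 2 (.inr p) - blockUnit _ _ 3 (.inr p)) ∧
      suElement m .V (.inr p) = (if p.1.2 ≤ m then
        Complex.I • (blockUnit _ _ 0 (.inr p) + blockUnit _ _ 1 (.inr p)) else
        Complex.I • (blockUnit _ _ 2 (.inr p) + blockUnit _ _ 3 (.inr p))) ∧
      suElement m .S (.inr p) = (if p.1.2 ≤ m then
        blockUnit _ _ 2 (.inr p) + blockUnit _ _ 3 (.inr p) else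
        -blockUnit _ _ 0 (.inr p) - blockUnit _ _ 1 (.inr p)) ∧
      suElement m .T (.inr p) = (if p.1.2 ≤ m then
        Complex.I • (blockUnit _ _ 2 (.inr p) - blockUnit _ _ 3 (.inr p)) else
        Complex.I • (blockUnit _ _ 1 (.inr p) - blockUnit _ _ 0 (.inr p))) := fun _ =>
    ⟨rfl, rfl, rfl, rfl⟩
  obtain ⟨x, β⟩ := a
  obtain ⟨y, γ⟩ := b
  by_cases hβ : β = γ
  · subst hβ
    obtain j | p := β
    · cases x <;> cases y <;> simp [suCoord, e1, h, h0, entry_smul] <;> norm_num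
    · by_cases hp : p.1.2 ≤ m <;> cases x <;> cases y <;> simp [suCoord, e2, h, hp, entry_smul]
  · have hab : ¬((x, β) = (y, γ)) := fun h' => hβ (congrArg Prod.snd h')
    have h' : ∀ c c', entry (blockPos c' γ) (blockUnit (m + (m - 1)) ℂ c β) = 0 := fun c c' => by
      rw [h, if_neg fun h => hβ h.2]
    have h'' : ∀ c', entry (blockPos c' γ) (suElement m x β) = 0 := fun c' => by
      obtain j | p := β
      · cases x <;> simp [e1, h', h0, entry_smul]
      · by_cases hp : p.1.2 ≤ m <;> cases x <;> simp [e2, h', hp, entry_smul]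
    rw [if_neg hab]
    obtain j | p := γ
    · cases y <;> simp [suCoord, h'']
    · by_cases hp : p.1.2 ≤ m <;> cases y <;> simp [suCoord, h'', hp]

/-- The diagonal entries of `signatureForm m (m - 1)`, numbered from `1`. -/
def signatureEntry (m j : ℕ) : ℂ := if j ≤ m then 1 else -1

lemma star_apply_mul_add_of_mem_su {m : ℕ} {X} (hX : X ∈ su m (m - 1)) (a b) :
    star (X b a) * signatureEntry m (b + 1) + signatureEntry m (a + 1) * X a b = 0 := by
  have h := congrFun (congrFun hX.1 a) b
  rw [signatureForm, Matrix.add_apply, Matrix.mul_diagonal, Matrix.diagonal_mul] at h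
  exact h

lemma star_mul_self_signatureEntry (m j : ℕ) : signatureEntry m j * signatureEntry m j = 1 := by
  unfold signatureEntry
  split_ifs <;> simp

/-- Invariance of the Hermitian form makes transposed entries conjugate up to sign. -/
lemma entry_swap_eq_zero_of_mem_su {m p q : ℕ} {X} (hX : X ∈ su m (m - 1))
    (hp : 1 ≤ p ∧ p ≤ m + (m - 1)) (hq : 1 ≤ q ∧ q ≤ m + (m - 1)) (h : entry (p, q) X = 0) :
    entry (q, p) X = 0 := by
  obtain ⟨a, b, -, -, h1, h2⟩ := exists_entry_eq (R := ℂ) hp hq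
  rw [h1] at h
  have h3 := star_apply_mul_add_of_mem_su hX b a
  rw [h, star_zero, zero_mul, zero_add] at h3
  have h4 := star_mul_self_signatureEntry m (b + 1)
  rw [h2]
  linear_combination signatureEntry m (b + 1) * h3 - X b a * h4

lemma entry_diag_re_eq_zero_of_mem_su {m p : ℕ} {X} (hX : X ∈ su m (m - 1))
    (hp : 1 ≤ p ∧ p ≤ m + (m - 1)) : (entry (p, p) X).re = 0 := by
  obtain ⟨a, b, ha, hb, h1, -⟩ := exists_entry_eq (R := ℂ) hp hp
  obtain rfl : a = b := Fin.ext (by omega)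
  have h3 := star_apply_mul_add_of_mem_su hX a a
  have h4 := star_mul_self_signatureEntry m (a + 1)
  have h5 : star (X a a) + X a a = 0 := by
    linear_combination signatureEntry m (a + 1) * h3 - (star (X a a) + X a a) * h4
  have h6 := congrArg Complex.re h5
  simp only [Complex.star_def, Complex.add_re, Complex.conj_re, Complex.zero_re] at h6
  rw [h1]
  linarith

lemma eq_zero_of_suCoord_eq_zero {m : ℕ} (hm : 0 < m) {X} (hX : X ∈ su m (m - 1))
    (h : suCoord m X = 0) : X = 0 := by
  have hn : m + (m - 1) + 1 = 2 * m := by omega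
  refine eq_zero_of_entry_blockPos (m := m) hn hX.2 ?_
  -- Some positions of a block are transposes of each other, and the coordinates read only one of
  -- the two.
  have swap : ∀ c c' (β : BlockIndex m), (blockPos c β).swap = blockPos c' β →
      entry (blockPos c β) X = 0 → entry (blockPos c' β) X = 0 := by
    intro c c' β e h0
    obtain ⟨h1, h2⟩ := blockPos_mem hn c β
    rw [← e]
    exact entry_swap_eq_zero_of_mem_su hX h1 h2 h0
  suffices h02 : ∀ β : BlockIndex m, entry (blockPos 0 β) X = 0 ∧ entry (blockPos 2 β) X = 0 ∧
      entry (blockPos 1 β) X = 0 by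
    intro c β
    obtain ⟨h0, h2, h1⟩ := h02 β
    fin_cases c
    · exact h0
    · exact h1
    · exact h2
    · obtain j | p := β <;> exact swap 2 3 _ rfl h2
  intro β
  have hU := congrFun h (.U, β)
  have hV := congrFun h (.V, β)
  have hS := congrFun h (.S, β)
  have hT := congrFun h (.T, β)
  obtain j | p := β
  · have r0 : (entry (blockPos 0 (.inl j)) X).re = 0 :=
      entry_diag_re_eq_zero_of_mem_su hX (blockPos_mem hn 0 (.inl j)).1
    have r1 : (entry (blockPos 1 (.inl j)) X).re = 0 :=
      entry_diag_re_eq_zero_of_mem_su hX (blockPos_mem hn 1 (.inl j)).1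
    simp [suCoord] at hU hV hS hT
    exact ⟨Complex.ext r0 (by simp; linarith), Complex.ext hS hT,
      Complex.ext r1 (by simp; linarith)⟩
  · have h0 : entry (blockPos 0 (.inr p)) X = 0 ∧ entry (blockPos 2 (.inr p)) X = 0 := by
      by_cases hp : p.1.2 ≤ m <;> simp [suCoord, hp] at hU hV hS hT
      · exact ⟨Complex.ext hU hV, Complex.ext hS hT⟩
      · exact ⟨Complex.ext hS hT, Complex.ext hU hV⟩
    exact ⟨h0.1, h0.2, swap 0 1 _ rfl h0.1⟩

lemma conjTranspose_mE {n : ℕ} (j k : ℕ) :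
    (mE j k : Matrix (Fin n) (Fin n) ℂ)ᴴ = mE k j := by
  ext a b
  simp [mE_apply, apply_ite (starRingEnd ℂ), and_comm]

lemma signatureForm_mul_mE (m j k : ℕ) :
    signatureForm m (m - 1) * mE j k = signatureEntry m j • mE j k := by
  ext a b
  rw [signatureForm, Matrix.diagonal_mul, Matrix.smul_apply, smul_eq_mul, mE_apply]
  by_cases h : (a : ℕ) + 1 = j ∧ (b : ℕ) + 1 = k
  · rw [if_pos h, mul_one, mul_one]
    exact if_congr (by omega) rfl rfl
  · rw [if_neg h, mul_zero, mul_zero]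

lemma mE_mul_signatureForm (m j k : ℕ) :
    mE j k * signatureForm m (m - 1) = signatureEntry m k • mE j k := by
  ext a b
  rw [signatureForm, Matrix.mul_diagonal, Matrix.smul_apply, smul_eq_mul, mE_apply]
  by_cases h : (a : ℕ) + 1 = j ∧ (b : ℕ) + 1 = k
  · rw [if_pos h, one_mul, mul_one]
    exact if_congr (by omega) rfl rfl
  · rw [if_neg h, zero_mul, mul_zero]

lemma suElement_mem {m : ℕ} (x : Letter) (β : BlockIndex m) :
    suElement m x β ∈ su m (m - 1) := by
  have sl : ∀ j, j ≤ m → signatureEntry m j = 1 := fun j h => if_pos h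
  have sg : ∀ j, ¬j ≤ m → signatureEntry m j = -1 := fun j h => if_neg h
  constructor
  · obtain ⟨j, h⟩ | ⟨⟨j, k⟩, h⟩ := β
    -- The form multiplies a matrix unit by the sign of its row or column. Since `j ≤ m < 2m - j`,
    -- two signs are fixed, and only that of `k` requires a case distinction in the other blocks.
    · have h1 := sl j (by omega)
      have h2 := sg (2 * m - j) (by omega)
      have h3 := sl m le_rfl
      cases x <;> simp only [suElement, conjTranspose_add, conjTranspose_sub, conjTranspose_smul,
        conjTranspose_mE, add_mul, sub_mul, mul_add, mul_sub, smul_mul_assoc, mul_smul_comm,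
        signatureForm_mul_mE, mE_mul_signatureForm, h1, h2, h3, Complex.star_def, Complex.conj_I,
        map_ofNat] <;> module
    · have h' : (1 ≤ j ∧ j ≤ m - 1) ∧ j < k ∧ k < 2 * m - j := h
      have h1 := sl j (by omega)
      have h2 := sg (2 * m - j) (by omega)
      by_cases hk : k ≤ m
      · have h3 := sl k hk
        cases x <;> simp only [suElement, hk, if_true, conjTranspose_add, conjTranspose_sub,
          conjTranspose_smul, conjTranspose_mE, add_mul, sub_mul, mul_add, mul_sub, smul_mul_assoc,
          mul_smul_comm, signatureForm_mul_mE, mE_mul_signatureForm, h1, h2, h3, Complex.star_def,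
          Complex.conj_I] <;> module
      · have h3 := sg k hk
        cases x <;> simp only [suElement, hk, if_false, conjTranspose_add, conjTranspose_sub,
          conjTranspose_smul, conjTranspose_neg, conjTranspose_mE, add_mul, sub_mul, neg_mul,
          mul_neg, mul_add, mul_sub, smul_mul_assoc, mul_smul_comm, signatureForm_mul_mE,
          mE_mul_signatureForm, h1, h2, h3, Complex.star_def, Complex.conj_I] <;> module
  · obtain ⟨j, h⟩ | ⟨⟨j, k⟩, h⟩ := β
    · cases x <;>
        simp only [suElement, trace_add, trace_sub, trace_smul, trace_mE, true_and] <;>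
        split_ifs <;> first | (exfalso; omega) | norm_num
    · have h' : (1 ≤ j ∧ j ≤ m - 1) ∧ j < k ∧ k < 2 * m - j := h
      have t1 : (mE j k : Matrix (Fin (m + (m - 1))) (Fin (m + (m - 1))) ℂ).trace = 0 := by
        rw [trace_mE, if_neg (by omega)]
      have t2 : (mE k j : Matrix (Fin (m + (m - 1))) (Fin (m + (m - 1))) ℂ).trace = 0 := by
        rw [trace_mE, if_neg (by omega)]
      have t3 : (mE k (2 * m - j) : Matrix (Fin (m + (m - 1))) (Fin (m + (m - 1))) ℂ).trace =
          0 := by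
        rw [trace_mE, if_neg (by omega)]
      have t4 : (mE (2 * m - j) k : Matrix (Fin (m + (m - 1))) (Fin (m + (m - 1))) ℂ).trace =
          0 := by
        rw [trace_mE, if_neg (by omega)]
      cases x <;> simp only [suElement] <;> split_ifs <;> simp [t1, t2, t3, t4]

lemma exists_basis_suElement {m : ℕ} (hm : 0 < m) :
    ∃ b : Module.Basis (Letter × BlockIndex m) ℝ (LieModel (su m (m - 1))),
      ∀ x β, (suData m (m - 1)).tang (b (x, β)) = suElement m x β := by
  obtain ⟨b, hb⟩ := exists_basis_lieModel (fun a => suElement m a.1 a.2)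
    (fun a => suElement_mem a.1 a.2) (suCoord m) (fun X => eq_zero_of_suCoord_eq_zero hm)
    (fun a b => by convert suCoord_suElement hm a b)
  exact ⟨b, fun x β => hb (x, β)⟩

end SuBasis

end

theorem theorem1p1 (m : ℕ) (hm : 1 < m) :
    (∃ P J : TangentEnd 𝓘(ℝ, LieModel (slR (2 * m - 1))) (SLR (2 * m - 1)),
      IsComplexProductStructure 𝓘(ℝ, LieModel (slR (2 * m - 1))) P J ∧
      IsLeftInvariant 𝓘(ℝ, LieModel (slR (2 * m - 1))) P ∧
      IsLeftInvariant 𝓘(ℝ, LieModel (slR (2 * m - 1))) J ∧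
      HasBlockForm (slData (2 * m - 1)) (slElement m) P J) ∧
    (∃ P J : TangentEnd 𝓘(ℝ, LieModel (su m (m - 1))) (SU m (m - 1)),
      IsComplexProductStructure 𝓘(ℝ, LieModel (su m (m - 1))) P J ∧
      IsLeftInvariant 𝓘(ℝ, LieModel (su m (m - 1))) P ∧
      IsLeftInvariant 𝓘(ℝ, LieModel (su m (m - 1))) J ∧
      HasBlockForm (suData m (m - 1)) (suElement m) P J) := by
  obtain ⟨b, hb⟩ := exists_basis_slElement (m := m) (by omega)
  obtain ⟨c, hc⟩ := exists_basis_suElement (m := m) (by omega)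
  exact ⟨slR_exists_isComplexProductStructure b hb hm, su_exists_isComplexProductStructure c hc hm⟩
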